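/- **Setting.** Let $X=(X_n)_{n\ge 0}$ be a time-homogeneous Markov chain on a finite set $\mathbb{X}\subset\mathbb{R}$ such that, from every initial state, $X_\infty:=\lim_{n\to\infty}X_n$ exists almost surely; $\mathbb{E}_x$ and $\mathrm{Var}_x$ refer to the chain started at $x$. Let $c>0$. For $\xi,\eta:\mathbb{X}\to[0,1]$ let $\theta^{\xi\otimes\eta}$ be the strategy that sells the proportion $\xi(X_0)$ of the asset at time $0$ and then, at each time $k\ge1$, the proportion $\eta(X_k)$ of what remains: $\theta^{\xi\otimes\eta}_n=1-(1-\xi(X_0))\prod_{k=1}^n(1-\eta(X_k))$; put $\theta^\eta=\theta^{\eta\otimes\eta}$. The payoff of a strategy $\theta$ is $\theta(X)=X_0\theta_0+\sum_{n\ge1}X_n(\theta_n-\theta_{n-1})+X_\infty(1-\theta_\infty)$, where $\theta_\infty=\lim_n\theta_n$, and its value is $$K(x,\theta)=\mathbb{E}_x[\theta(X)]-c\,\bigl(\mathrm{Var}_x[\theta(X)]\bigr)^{1/2}.$$ A function $\eta:\mathbb{X}\to[0,1]$ is an *equilibrium liquidation strategy* if $K(x,\theta^{\xi\otimes\eta})\le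 K(x,\theta^{\eta\otimes\eta})$ for all $\xi:\mathbb{X}\to[0,1]$ and all $x\in\mathbb{X}$. An equilibrium $\eta^*$ is *optimal* if $K(x,\theta^{\eta^*})\ge K(x,\theta^{\eta})$ for all $x\in\mathbb{X}$ and all equilibria $\eta$. Since the value of $\eta$ at an absorbing state does not affect the payoff, equilibria are counted with the normalisation $\eta=1$ at every absorbing state. **Proposition.** An optimal equilibrium liquidation strategy may fail to exist, and when it exists it may fail to be unique. More precisely, in each of the following three chains the limit $X_\infty$ exists almost surely from every initial state, and: (i) Let $c=0.4$, $\mathbb{X}=\{0,1,2,7,9\}$, with $0,2,9$ absorbing, transitions from $1$ to $0,2,7,9$ with probabilities $0.2,0.4,0.2,0.2$, and from $7$ to $1,9$ with probabilities $0.2,0.8$. There are exactly three equilibria: for some $b_0\in(0,1)$ they are given by $(\eta(1),\eta(7))=(0,0),\ (0,b_0),\ (0,1)$. Exactly one of them is optimal, namely $(0,0)$. (ii) Let $c=0.1$, $\mathbb{X}=\{0,11,17,18\}$, with $0,18$ absorbing, transitions from $11$ to $0,11,18$ with probabilities $0.1,0.7,0.2$, and from $17$ to $11,17,18$ with probabilities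 $0.1,0.1,0.8$. There are exactly five equilibria: for some $a_3,b_0\in(0,1)$ they are given by $(\eta(11),\eta(17))=(1,1),\ (0,1),\ (1,0),\ (a_3,0),\ (1,b_0)$. No equilibrium is optimal. (iii) Let $c=0.5$, $\mathbb{X}=\{0,1,4\}$, with $0,4$ absorbing and transitions from $1$ to $0,1,4$ with probabilities $0.1,0.8,0.1$. There are exactly two equilibria, $\eta(1)=0$ and $\eta(1)=1$, and both are optimal. -/

import Mathlib

open MeasureTheory ProbabilityTheory Filter Topology

noncomputable section

namespace Liquidation

/-- A time-homogeneous Markov chain on a finite set of real numbers: the state with index `i` is the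
real number `state i`, and `trans i j` is the probability to move from `state i` to `state j`. -/
structure FiniteChain (n : ℕ) where
  state : Fin n → ℝ
  state_injective : Function.Injective state
  trans : Matrix (Fin n) (Fin n) ℝ
  trans_mem : trans ∈ Matrix.rowStochastic ℝ (Fin n)

namespace FiniteChain

variable {n : ℕ} (M : FiniteChain n)

/-- The law of one step: from `i`, the chain moves to `j` with probability `trans i j`. -/
def step : Kernel (Fin n) (Fin n) :=
  Kernel.ofFunOfCountable
    (fun i ↦ ∑ j, ENNReal.ofReal (M.trans i j) • Measure.dirac j)

instance : IsMarkovKernel M.step where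
  isProbabilityMeasure i := ⟨by
    have h := Matrix.mem_rowStochastic_iff_sum.1 M.trans_mem
    have e : M.step i = ∑ j, ENNReal.ofReal (M.trans i j) • Measure.dirac j := rfl
    rw [e]
    simp only [Measure.coe_finsetSum, Finset.sum_apply, Measure.smul_apply, measure_univ,
      smul_eq_mul, mul_one]
    rw [← ENNReal.ofReal_sum_of_nonneg (fun j _ ↦ h.1 i j), h.2 i, ENNReal.ofReal_one]⟩

/-- The law of the next state given the path up to time `k`: it depends on the state at time `k`
only. -/
def pathStep (k : ℕ) : Kernel (∀ _ : Finset.Iic k, Fin n) (Fin n) :=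
  M.step.comap (fun h ↦ h ⟨k, Finset.mem_Iic.2 le_rfl⟩) (measurable_pi_apply _)

instance (k : ℕ) : IsMarkovKernel (M.pathStep k) := by
  unfold pathStep; infer_instance

/-- `ℙ_x`: the law, on the space of paths `ℕ → Fin n`, of the chain started from `x`. -/
def pathLaw (x : Fin n) : Measure (ℕ → Fin n) :=
  Kernel.trajMeasure (X := fun _ ↦ Fin n) (Measure.dirac x) M.pathStep

/-- `X_k`, on the path space. -/
def X (k : ℕ) (ω : ℕ → Fin n) : ℝ := M.state (ω k)

/-- `X_∞ = lim X_k`. -/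
def XInf (ω : ℕ → Fin n) : ℝ := limUnder atTop (fun k ↦ M.X k ω)

/-- The standing assumption: from every initial state, `lim X_k` exists almost surely. -/
def Converges : Prop :=
  ∀ x, ∀ᵐ ω ∂(M.pathLaw x), ∃ l : ℝ, Tendsto (fun k ↦ M.X k ω) atTop (𝓝 l)

/-- The state `x` is absorbing. -/
def Absorbing (x : Fin n) : Prop := M.trans x x = 1

/-- The payoff `θ(X) = X₀ θ₀ + ∑_{k ≥ 1} X_k (θ_k - θ_{k-1}) + X_∞ (1 - θ_∞)` of the liquidation
strategy `θ`, where `θ k ω` is the fraction of the asset sold up to time `k` along the path `ω`. -/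
def payoff (θ : ℕ → (ℕ → Fin n) → ℝ) (ω : ℕ → Fin n) : ℝ :=
  M.X 0 ω * θ 0 ω + ∑' k : ℕ, M.X (k + 1) ω * (θ (k + 1) ω - θ k ω)
    + M.XInf ω * (1 - limUnder atTop (fun k ↦ θ k ω))

/-- The mean-standard deviation objective `K_l(x, θ) = 𝔼_x[θ(X)] - c (Var_x[θ(X)])^{1/2}`. -/
def objective (c : ℝ) (x : Fin n) (θ : ℕ → (ℕ → Fin n) → ℝ) : ℝ :=
  (∫ ω, M.payoff θ ω ∂(M.pathLaw x)) - c * √(variance (M.payoff θ) (M.pathLaw x))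

end FiniteChain

variable {n : ℕ}

/-- `η` takes values in `[0,1]`; `η x` is the proportion of the remaining asset to be sold when the
chain is at `x`. -/
def IsStrategy (η : Fin n → ℝ) : Prop := ∀ x, η x ∈ Set.Icc (0 : ℝ) 1

/-- The time-homogeneous liquidation strategy `θ^η`: `θ_k = 1 - ∏_{i ≤ k} (1 - η(x_i))`. -/
def homogeneous (η : Fin n → ℝ) (k : ℕ) (ω : ℕ → Fin n) : ℝ :=
  1 - ∏ i ∈ Finset.range (k + 1), (1 - η (ω i))

/-- The perturbed strategy `θ^{ξ ⊗ η}`: sell the proportion `ξ` at time `0` and, from time `1` on,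
the proportion `η` of the remaining asset at each period. -/
def perturbed (ξ η : Fin n → ℝ) (k : ℕ) (ω : ℕ → Fin n) : ℝ :=
  1 - (1 - ξ (ω 0)) * ∏ i ∈ Finset.range k, (1 - η (ω (i + 1)))

namespace FiniteChain

variable (M : FiniteChain n)

/-- `η` is an equilibrium liquidation strategy. -/
def IsEquilibrium (c : ℝ) (η : Fin n → ℝ) : Prop :=
  IsStrategy η ∧ ∀ ξ : Fin n → ℝ, IsStrategy ξ → ∀ x,
    M.objective c x (perturbed ξ η) ≤ M.objective c x (perturbed η η)

/-- `η` is an optimal equilibrium liquidation strategy: an equilibrium whose value dominates, at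
every state, the value of every equilibrium. -/
def IsOptimal (c : ℝ) (η : Fin n → ℝ) : Prop :=
  M.IsEquilibrium c η ∧ ∀ η' : Fin n → ℝ, M.IsEquilibrium c η' → ∀ x,
    M.objective c x (homogeneous η') ≤ M.objective c x (homogeneous η)

/-- The set of equilibrium liquidation strategies, normalised (as is usual, because the value of `η`
at an absorbing state has no effect on the payoff) by `η = 1` at the absorbing states. -/
def equilibria (c : ℝ) : Set (Fin n → ℝ) :=
  {η | M.IsEquilibrium c η ∧ ∀ x, M.Absorbing x → η x = 1}

end FiniteChain

/-- The chain on `{0, 1, 2, 7, 9}`. -/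
def chainA : FiniteChain 5 where
  state := ![0, 1, 2, 7, 9]
  state_injective := by
    intro i j h
    fin_cases i <;> fin_cases j <;> simp at h ⊢
  trans := !![1, 0, 0, 0, 0;
    1/5, 0, 2/5, 1/5, 1/5;
    0, 0, 1, 0, 0;
    0, 1/5, 0, 0, 4/5;
    0, 0, 0, 0, 1]
  trans_mem := by
    rw [Matrix.mem_rowStochastic_iff_sum]
    constructor
    · intro i j
      fin_cases i <;> fin_cases j <;> simp <;> norm_num
    · intro i
      fin_cases i <;> simp [Fin.sum_univ_succ] <;> norm_num

/-- The chain on `{0, 11, 17, 18}`. -/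
def chainB : FiniteChain 4 where
  state := ![0, 11, 17, 18]
  state_injective := by
    intro i j h
    fin_cases i <;> fin_cases j <;> simp at h ⊢
  trans := !![1, 0, 0, 0;
    1/10, 7/10, 0, 1/5;
    0, 1/10, 1/10, 4/5;
    0, 0, 0, 1]
  trans_mem := by
    rw [Matrix.mem_rowStochastic_iff_sum]
    constructor
    · intro i j
      fin_cases i <;> fin_cases j <;> simp <;> norm_num
    · intro i
      fin_cases i <;> simp [Fin.sum_univ_succ] <;> norm_num

/-- The chain on `{0, 1, 4}`. -/
def chainC : FiniteChain 3 where
  state := ![0, 1, 4]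
  state_injective := by
    intro i j h
    fin_cases i <;> fin_cases j <;> simp at h ⊢
  trans := !![1, 0, 0;
    1/10, 4/5, 1/10;
    0, 0, 1]
  trans_mem := by
    rw [Matrix.mem_rowStochastic_iff_sum]
    constructor
    · intro i j
      fin_cases i <;> fin_cases j <;> simp <;> norm_num
    · intro i
      fin_cases i <;> simp [Fin.sum_univ_succ] <;> norm_num

end Liquidation

end

open MeasureTheory ProbabilityTheory Filter Topology

noncomputable section

namespace Liquidation

/-! By the Markov property, the payoff of a perturbed strategy started at `x` is `ξ x * state x + (1
- ξ x) * R`, where `R` is the payoff of `θ^η` along the path shifted by one step. Since the standard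
deviation is positively homogeneous and ignores constants, the objective is affine in `ξ x`: it
interpolates between the state itself and the value `waitValue` of selling nothing now
(`objective_perturbed`). So `η` is an equilibrium iff at every state waiting is at least as good as
selling when `η x < 1`, and at most as good when `0 < η x` (`isEquilibrium_iff`).

Let `u` and `w` be the first and second moments of `R` about the current state. If `0 ≤ u`, waiting
is no better than selling iff `(1 + c²) u² ≤ c² w`, and no worse iff the reverse inequality holds
(`waitValue_le_iff`, `le_waitValue_iff`). The moments solve linear one-step equations, so clearing
positive denominators leaves explicit polynomial inequalities in the unsold fractions. When such a
polynomial is a convex quadratic that favours selling at full sale and waiting at no sale, the best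
responses are exactly `0`, one interior root, and `1` (`exists_best_response`).

On {0,1,2,7,9}, waiting is always strictly better at 1, so `η(1) = 0`, and the quadratic at 7 gives
three equilibria; waiting at both states gives the largest value at 1 and at 7. On {0,11,17,18},
state 11 is autonomous and has three solutions; the responses at 17 are three, one and one. An
optimal equilibrium would have to wait at both 11 and 17, yet waiting at 11 makes selling strictly
better at 17. On {0,1,4}, the quadratic is a negative multiple of `(η 1)²`: waiting never beats
selling, and ties with it exactly when `η 1 = 0`. -/

/-! ### Path space, cylinder probabilities and the Markov property. -/

/-- The path observed from time `1` on. -/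
def shift {α : Type*} (ω : ℕ → α) (k : ℕ) : α := ω (k + 1)

lemma measurable_shift {α : Type*} [MeasurableSpace α] : Measurable (shift : (ℕ → α) → ℕ → α) :=
  measurable_pi_lambda _ fun k ↦ measurable_pi_apply (k + 1)

/-- The paths that agree with `a` up to time `k`. -/
def initialCylinder {α : Type*} (k : ℕ) (a : ℕ → α) : Set (ℕ → α) := {ω | ∀ i ≤ k, ω i = a i}

lemma initialCylinder_eq_preimage {α : Type*} (k : ℕ) (a : ℕ → α) :
    initialCylinder k a =
      (Preorder.frestrictLe (π := fun _ ↦ α) k) ⁻¹' {Preorder.frestrictLe (π := fun _ ↦ α) k a} := by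
  ext ω
  simp only [initialCylinder, Set.mem_ofPred_eq, Set.mem_preimage, Set.mem_singleton_iff, funext_iff,
    Preorder.frestrictLe_apply, Subtype.forall, Finset.mem_Iic]

/-- There are finitely many paths up to time `k`, so cylinder masses determine the marginal on `Iic
k`; every finite-dimensional marginal factors through one of these, and projective limits are
unique. -/
lemma measure_ext_of_initialCylinder {n : ℕ} {μ ν : Measure (ℕ → Fin n)} [IsFiniteMeasure ν]
    (h : ∀ k a, μ (initialCylinder k a) = ν (initialCylinder k a)) : μ = ν := by
  have key : ∀ k, μ.map (Preorder.frestrictLe (π := fun _ ↦ Fin n) k) =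
      ν.map (Preorder.frestrictLe (π := fun _ ↦ Fin n) k) := by
    intro k
    refine Measure.ext_of_singleton fun b ↦ ?_
    have hm := Preorder.measurable_frestrictLe (X := fun _ ↦ Fin n) k
    rw [Measure.map_apply hm (measurableSet_singleton _),
      Measure.map_apply hm (measurableSet_singleton _)]
    obtain ⟨a, rfl⟩ : ∃ a : ℕ → Fin n, Preorder.frestrictLe (π := fun _ ↦ Fin n) k a = b := by
      -- Any extension of the finite path works; this one repeats its last state.
      refine ⟨fun i ↦ if hi : i ≤ k then b ⟨i, Finset.mem_Iic.2 hi⟩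
        else b ⟨k, Finset.mem_Iic.2 le_rfl⟩, ?_⟩
      ext ⟨i, hi⟩
      simp [Preorder.frestrictLe_apply, Finset.mem_Iic.1 hi]
    rw [← initialCylinder_eq_preimage]
    exact h k a
  have hr (ρ : Measure (ℕ → Fin n)) (I : Finset ℕ) : ρ.map I.restrict =
      (ρ.map (Preorder.frestrictLe (π := fun _ ↦ Fin n) (I.sup id))).map
        (Finset.restrict₂ (π := fun _ ↦ Fin n) I.subset_Iic_sup_id) :=
    (Measure.map_map (Finset.measurable_restrict₂ _) (Preorder.measurable_frestrictLe _)).symm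
  refine IsProjectiveLimit.unique (P := fun I ↦ ν.map I.restrict) (fun I ↦ ?_) (fun I ↦ rfl)
  exact (hr μ I).trans ((congrArg _ (key _)).trans (hr ν I).symm)

namespace FiniteChain

variable {n : ℕ} (M : FiniteChain n)

instance (x : Fin n) : IsProbabilityMeasure (M.pathLaw x) := by
  unfold pathLaw; infer_instance

lemma trans_nonneg (i j : Fin n) : 0 ≤ M.trans i j :=
  (Matrix.mem_rowStochastic_iff_sum.1 M.trans_mem).1 i j

lemma sum_trans (i : Fin n) : ∑ j, M.trans i j = 1 :=
  (Matrix.mem_rowStochastic_iff_sum.1 M.trans_mem).2 i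

lemma step_singleton (i j : Fin n) : M.step i {j} = ENNReal.ofReal (M.trans i j) := by
  change (∑ j, ENNReal.ofReal (M.trans i j) • Measure.dirac j : Measure (Fin n)) {j} = _
  simp [Measure.finsetSum_apply, Set.indicator_apply]

lemma pathLaw_map_zero (x : Fin n) : (M.pathLaw x).map (fun ω ↦ ω 0) = Measure.dirac x := by
  have h : (M.pathLaw x).map (fun ω ↦ ω 0) =
      ((M.pathLaw x).map (Preorder.frestrictLe (π := fun _ ↦ Fin n) 0)).map
        (fun y : (∀ _ : Finset.Iic 0, Fin n) ↦ y ⟨0, Finset.mem_Iic.2 le_rfl⟩) :=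
    (Measure.map_map (f := Preorder.frestrictLe (π := fun _ ↦ Fin n) 0)
      (g := fun y : (∀ _ : Finset.Iic 0, Fin n) ↦ y ⟨0, Finset.mem_Iic.2 le_rfl⟩)
      (measurable_pi_apply _) (Preorder.measurable_frestrictLe _)).symm
  rw [h, pathLaw,
    Kernel.trajMeasure, Measure.map_comp _ _ (Preorder.measurable_frestrictLe _),
    Kernel.traj_map_frestrictLe, Kernel.partialTraj_self, Measure.id_comp,
    Measure.map_map (measurable_pi_apply _) (MeasurableEquiv.measurable _)]
  exact Measure.map_id

lemma ae_zero (x : Fin n) : ∀ᵐ ω ∂(M.pathLaw x), ω 0 = x := by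
  have h : ∀ᵐ y ∂((M.pathLaw x).map (fun ω ↦ ω 0)), y = x := by
    rw [pathLaw_map_zero]
    exact (ae_dirac_iff (measurableSet_singleton x)).2 rfl
  exact ae_of_ae_map (measurable_pi_apply 0).aemeasurable h

lemma pathLaw_initialCylinder_succ (x : Fin n) (k : ℕ) (a : ℕ → Fin n) :
    M.pathLaw x (initialCylinder (k + 1) a) =
      M.pathLaw x (initialCylinder k a) * ENNReal.ofReal (M.trans (a k) (a (k + 1))) := by
  have hf := Preorder.measurable_frestrictLe (X := fun _ ↦ Fin n) k
  have h := Kernel.map_frestrictLe_trajMeasure_compProd_eq_map_trajMeasure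
    (X := fun _ ↦ Fin n) (μ₀ := Measure.dirac x) (κ := M.pathStep) (a := k)
  have h' := DFunLike.congr_fun h
    ({Preorder.frestrictLe (π := fun _ ↦ Fin n) k a} ×ˢ {a (k + 1)})
  rw [Measure.compProd_apply_prod (measurableSet_singleton _) (measurableSet_singleton _),
    Measure.map_apply (hf.prodMk (measurable_pi_apply _))
      ((measurableSet_singleton _).prod (measurableSet_singleton _)),
    lintegral_singleton, Measure.map_apply hf (measurableSet_singleton _),
    ← initialCylinder_eq_preimage] at h'
  have e : (fun ω : ℕ → Fin n ↦ (Preorder.frestrictLe (π := fun _ ↦ Fin n) k ω, ω (k + 1))) ⁻¹'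
      ({Preorder.frestrictLe (π := fun _ ↦ Fin n) k a} ×ˢ {a (k + 1)}) =
      initialCylinder (k + 1) a := by
    rw [Set.mk_preimage_prod, ← initialCylinder_eq_preimage]
    ext ω
    simp only [initialCylinder, Set.mem_inter_iff, Set.mem_ofPred_eq, Set.mem_preimage,
      Set.mem_singleton_iff]
    constructor
    · rintro ⟨h₁, h₂⟩ i hi
      rcases Nat.le_succ_iff.1 hi with hi | rfl
      · exact h₁ i hi
      · exact h₂
    · exact fun h ↦ ⟨fun i hi ↦ h i (hi.trans k.le_succ), h _ le_rfl⟩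
  rw [e] at h'
  rw [pathLaw, ← h', mul_comm]
  congr 1
  exact M.step_singleton (a k) (a (k + 1))

lemma pathLaw_initialCylinder (x : Fin n) (k : ℕ) (a : ℕ → Fin n) :
    M.pathLaw x (initialCylinder k a) = (if a 0 = x then 1 else 0) *
      ∏ i ∈ Finset.range k, ENNReal.ofReal (M.trans (a i) (a (i + 1))) := by
  induction k with
  | zero =>
    have e : initialCylinder 0 a = (fun ω : ℕ → Fin n ↦ ω 0) ⁻¹' {a 0} := by
      ext ω; simp [initialCylinder]
    rw [e, ← Measure.map_apply (measurable_pi_apply 0) (measurableSet_singleton _),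
      pathLaw_map_zero]
    simp [Set.indicator_apply, eq_comm]
  | succ k ih => rw [pathLaw_initialCylinder_succ, ih, Finset.prod_range_succ, mul_assoc]

/-- The Markov property at time `1`. -/
lemma pathLaw_map_shift (x : Fin n) :
    (M.pathLaw x).map shift = ∑ j, ENNReal.ofReal (M.trans x j) • M.pathLaw j := by
  have hfin : IsFiniteMeasure (∑ j, ENNReal.ofReal (M.trans x j) • M.pathLaw j) := by
    have (j : Fin n) : IsFiniteMeasure (ENNReal.ofReal (M.trans x j) • M.pathLaw j) :=
      Measure.smul_finite _ ENNReal.ofReal_ne_top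
    infer_instance
  refine measure_ext_of_initialCylinder fun k a ↦ ?_
  have hm : MeasurableSet (initialCylinder k a) := by
    rw [initialCylinder_eq_preimage]
    exact Preorder.measurable_frestrictLe _ (measurableSet_singleton _)
  rw [Measure.map_apply measurable_shift hm]
  -- The path on the right is `a` with `x` prepended; the two events differ only where `ω 0 ≠ x`, a
  -- null set.
  have e : M.pathLaw x (shift ⁻¹' initialCylinder k a) =
      M.pathLaw x (initialCylinder (k + 1) (fun i ↦ Nat.casesOn i x a)) := by
    refine measure_congr ?_
    filter_upwards [M.ae_zero x] with ω hω
    refine propext ?_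
    change (∀ i ≤ k, ω (i + 1) = a i) ↔ ∀ i ≤ k + 1, ω i = _
    refine ⟨fun h i hi ↦ ?_, fun h i hi ↦ h (i + 1) (Nat.succ_le_succ hi)⟩
    cases i with
    | zero => exact hω
    | succ i => exact h i (Nat.le_of_succ_le_succ hi)
  rw [e, pathLaw_initialCylinder, Finset.prod_range_succ', Measure.finsetSum_apply]
  simp [pathLaw_initialCylinder, mul_comm]

lemma integral_comp_shift (x : Fin n) {f : (ℕ → Fin n) → ℝ} (hf : Measurable f)
    (hi : ∀ j, Integrable f (M.pathLaw j)) :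
    ∫ ω, f (shift ω) ∂(M.pathLaw x) = ∑ j, M.trans x j * ∫ ω, f ω ∂(M.pathLaw j) := by
  rw [← integral_map measurable_shift.aemeasurable hf.aestronglyMeasurable, pathLaw_map_shift,
    integral_finsetSum_measure fun j _ ↦ (hi j).smul_measure ENNReal.ofReal_ne_top]
  refine Finset.sum_congr rfl fun j _ ↦ ?_
  rw [integral_smul_measure, ENNReal.toReal_ofReal (M.trans_nonneg x j), smul_eq_mul]

variable {M}

lemma Absorbing.trans_eq {x : Fin n} (h : M.Absorbing x) (j : Fin n) :
    M.trans x j = if j = x then 1 else 0 := by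
  split_ifs with hj
  · rw [hj]; exact h
  · have h₁ := M.sum_trans x
    rw [← Finset.add_sum_erase _ _ (Finset.mem_univ x), h, add_eq_left] at h₁
    exact (Finset.sum_eq_zero_iff_of_nonneg fun i _ ↦ M.trans_nonneg x i).1 h₁ j
      (Finset.mem_erase.2 ⟨hj, Finset.mem_univ j⟩)

lemma Absorbing.sum_mul {x : Fin n} (h : M.Absorbing x) (f : Fin n → ℝ) :
    ∑ j, M.trans x j * f j = f x := by
  simp [h.trans_eq]

/-- The law from an absorbing state is shift-invariant, so the property at time `0` propagates to
all times. -/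
lemma Absorbing.ae_eq {x : Fin n} (h : M.Absorbing x) : ∀ᵐ ω ∂(M.pathLaw x), ∀ k, ω k = x := by
  have hs : (M.pathLaw x).map shift = M.pathLaw x := by
    rw [pathLaw_map_shift, Finset.sum_eq_single x]
    · rw [h.trans_eq, if_pos rfl, ENNReal.ofReal_one, one_smul]
    · intro j _ hj
      rw [h.trans_eq, if_neg hj, ENNReal.ofReal_zero, zero_smul]
    · exact fun hx ↦ (hx (Finset.mem_univ x)).elim
  refine ae_all_iff.2 fun k ↦ ?_
  induction k with
  | zero => exact M.ae_zero x
  | succ k ih =>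
    rw [← hs] at ih
    exact ae_of_ae_map measurable_shift.aemeasurable ih

variable (M)

lemma measurable_X (k : ℕ) : Measurable (M.X k) :=
  (measurable_of_countable M.state).comp (measurable_pi_apply k)

/-! ### Almost sure convergence. -/

/-- The probability that the chain started at `x` does not converge. -/
def divergenceProb (x : Fin n) : ℝ :=
  ∫ ω, {ω | ¬ ∃ l : ℝ, Tendsto (fun k ↦ M.X k ω) atTop (𝓝 l)}.indicator 1 ω ∂(M.pathLaw x)

lemma measurableSet_divergence :
    MeasurableSet {ω | ¬ ∃ l : ℝ, Tendsto (fun k ↦ M.X k ω) atTop (𝓝 l)} :=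
  (measurableSet_exists_tendsto (l := atTop) M.measurable_X).compl

/-- Divergence is a shift-invariant event, hence its probability is harmonic. In each chain below
this linear system, with zeros at the absorbing states, has only the zero solution. -/
lemma divergenceProb_eq_sum (x : Fin n) :
    M.divergenceProb x = ∑ j, M.trans x j * M.divergenceProb j := by
  simp only [divergenceProb]
  rw [← M.integral_comp_shift x (measurable_one.indicator M.measurableSet_divergence)
    fun j ↦ (integrable_const 1).indicator M.measurableSet_divergence]
  refine integral_congr_ae (ae_of_all _ fun ω ↦ ?_)
  have e : (∃ l : ℝ, Tendsto (fun k ↦ M.X k (shift ω)) atTop (𝓝 l)) ↔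
      ∃ l : ℝ, Tendsto (fun k ↦ M.X k ω) atTop (𝓝 l) :=
    exists_congr fun l ↦ tendsto_add_atTop_iff_nat (f := fun k ↦ M.X k ω) 1
  change Set.indicator _ (fun _ ↦ (1 : ℝ)) ω = Set.indicator _ (fun _ ↦ (1 : ℝ)) (shift ω)
  by_cases h : ∃ l : ℝ, Tendsto (fun k ↦ M.X k ω) atTop (𝓝 l)
  · rw [Set.indicator_of_notMem (not_not_intro h), Set.indicator_of_notMem
      (not_not_intro (e.2 h))]
  · have hs : shift ω ∈ {ω | ¬ ∃ l : ℝ, Tendsto (fun k ↦ M.X k ω) atTop (𝓝 l)} := e.not.2 h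
    rw [Set.indicator_of_mem h, Set.indicator_of_mem hs]

lemma converges_iff : M.Converges ↔ ∀ x, M.divergenceProb x = 0 := by
  refine forall_congr' fun x ↦ ?_
  rw [divergenceProb, integral_indicator_one M.measurableSet_divergence,
    measureReal_eq_zero_iff, ae_iff]

lemma Absorbing.divergenceProb {M : FiniteChain n} {x : Fin n} (h : M.Absorbing x) :
    M.divergenceProb x = 0 := by
  rw [FiniteChain.divergenceProb, integral_indicator_one M.measurableSet_divergence,
    measureReal_eq_zero_iff, ← ae_iff]
  filter_upwards [h.ae_eq] with ω hω
  refine ⟨M.state x, ?_⟩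
  simp only [X, hω]
  exact tendsto_const_nhds

end FiniteChain

/-! ### Unsold proportions and pathwise identities for the payoff. -/

section revenue

variable {n : ℕ}

/-- The proportion of the asset that `θ^η` has not sold before time `k`. -/
def unsold (η : Fin n → ℝ) (k : ℕ) (ω : ℕ → Fin n) : ℝ :=
  ∏ i ∈ Finset.range k, (1 - η (ω i))

section unsold

variable {η : Fin n → ℝ}

lemma unsold_zero (η : Fin n → ℝ) (ω : ℕ → Fin n) : unsold η 0 ω = 1 := by simp [unsold]

lemma unsold_succ (η : Fin n → ℝ) (k : ℕ) (ω : ℕ → Fin n) :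
    unsold η (k + 1) ω = unsold η k ω * (1 - η (ω k)) := by
  simp [unsold, Finset.prod_range_succ]

lemma unsold_nonneg (hη : IsStrategy η) (k : ℕ) (ω : ℕ → Fin n) : 0 ≤ unsold η k ω :=
  Finset.prod_nonneg fun i _ ↦ sub_nonneg.2 (hη (ω i)).2

lemma antitone_unsold (hη : IsStrategy η) (ω : ℕ → Fin n) : Antitone fun k ↦ unsold η k ω := by
  refine antitone_nat_of_succ_le fun k ↦ ?_
  rw [unsold_succ]
  exact mul_le_of_le_one_right (unsold_nonneg hη k ω) (by linarith [(hη (ω k)).1])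

lemma bddBelow_unsold (hη : IsStrategy η) (ω : ℕ → Fin n) :
    BddBelow (Set.range fun k ↦ unsold η k ω) :=
  ⟨0, by rintro _ ⟨k, rfl⟩; exact unsold_nonneg hη k ω⟩

/-- The proportion of the asset that `θ^η` never sells. -/
def unsoldInf (η : Fin n → ℝ) (ω : ℕ → Fin n) : ℝ := ⨅ k, unsold η k ω

lemma tendsto_unsold (hη : IsStrategy η) (ω : ℕ → Fin n) :
    Tendsto (fun k ↦ unsold η k ω) atTop (𝓝 (unsoldInf η ω)) :=
  tendsto_atTop_ciInf (antitone_unsold hη ω) (bddBelow_unsold hη ω)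

lemma unsoldInf_mem (hη : IsStrategy η) (ω : ℕ → Fin n) : unsoldInf η ω ∈ Set.Icc (0 : ℝ) 1 :=
  ⟨le_ciInf fun k ↦ unsold_nonneg hη k ω,
    (ciInf_le (bddBelow_unsold hη ω) 0).trans_eq (unsold_zero η ω)⟩

lemma hasSum_unsold_sub (hη : IsStrategy η) (ω : ℕ → Fin n) :
    HasSum (fun k ↦ unsold η k ω - unsold η (k + 1) ω) (1 - unsoldInf η ω) := by
  rw [hasSum_iff_tendsto_nat_of_nonneg fun k ↦ sub_nonneg.2 (antitone_unsold hη ω k.le_succ)]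
  simp_rw [Finset.sum_range_sub' (fun k ↦ unsold η k ω), unsold_zero]
  exact (tendsto_unsold hη ω).const_sub 1

lemma measurable_unsold (η : Fin n → ℝ) (k : ℕ) : Measurable (unsold η k) :=
  Finset.measurable_fun_prod _ fun i _ ↦
    (measurable_of_countable fun x ↦ 1 - η x).comp (measurable_pi_apply i)

lemma perturbed_eq (ξ η : Fin n → ℝ) (k : ℕ) (ω : ℕ → Fin n) :
    perturbed ξ η k ω = 1 - (1 - ξ (ω 0)) * unsold η k (shift ω) := rfl

lemma homogeneous_eq (η : Fin n → ℝ) : homogeneous η = perturbed η η := by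
  funext k ω
  rw [homogeneous, perturbed, Finset.prod_range_succ', mul_comm]

end unsold

namespace FiniteChain

variable (M : FiniteChain n) {η : Fin n → ℝ}

/-- A bound for the absolute value of the chain. -/
def bound : ℝ := ∑ i, |M.state i|

lemma abs_X_le (k : ℕ) (ω : ℕ → Fin n) : |M.X k ω| ≤ M.bound :=
  Finset.single_le_sum (f := fun i ↦ |M.state i|) (fun _ _ ↦ abs_nonneg _) (Finset.mem_univ (ω k))

/-- The payoff of `θ^η`, written in terms of the unsold proportions. -/
def revenue (η : Fin n → ℝ) (ω : ℕ → Fin n) : ℝ :=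
  ∑' k, M.X k ω * (unsold η k ω - unsold η (k + 1) ω) + M.XInf ω * unsoldInf η ω

lemma norm_revenueTerm_le (hη : IsStrategy η) (ω : ℕ → Fin n) (k : ℕ) :
    ‖M.X k ω * (unsold η k ω - unsold η (k + 1) ω)‖ ≤
      M.bound * (unsold η k ω - unsold η (k + 1) ω) := by
  have h := sub_nonneg.2 (antitone_unsold hη ω k.le_succ)
  rw [norm_mul, Real.norm_eq_abs, Real.norm_of_nonneg h]
  exact mul_le_mul_of_nonneg_right (M.abs_X_le k ω) h

lemma summable_revenueTerm (hη : IsStrategy η) (ω : ℕ → Fin n) :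
    Summable fun k ↦ M.X k ω * (unsold η k ω - unsold η (k + 1) ω) :=
  Summable.of_norm_bounded ((hasSum_unsold_sub hη ω).summable.mul_left _)
    (M.norm_revenueTerm_le hη ω)

/-- The two image filters coincide, so the identity also covers divergent paths, where `limUnder` is
a default value. This makes the payoff identities hold on every path. -/
lemma XInf_shift (ω : ℕ → Fin n) : M.XInf (shift ω) = M.XInf ω := by
  have h : map (fun k ↦ M.X k (shift ω)) atTop = map (fun k ↦ M.X k ω) atTop := by
    conv_rhs => rw [← map_add_atTop_eq_nat 1, Filter.map_map]
    rfl
  rw [XInf, XInf, limUnder, limUnder, h]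

lemma payoff_perturbed (ξ : Fin n → ℝ) (hη : IsStrategy η) (ω : ℕ → Fin n) :
    M.payoff (perturbed ξ η) ω =
      ξ (ω 0) * M.state (ω 0) + (1 - ξ (ω 0)) * M.revenue η (shift ω) := by
  have h₁ : limUnder atTop (fun k ↦ perturbed ξ η k ω) =
      1 - (1 - ξ (ω 0)) * unsoldInf η (shift ω) :=
    (((tendsto_unsold hη (shift ω)).const_mul _).const_sub _).limUnder_eq
  have h₂ (k : ℕ) : M.X (k + 1) ω * (perturbed ξ η (k + 1) ω - perturbed ξ η k ω) =
      (1 - ξ (ω 0)) * (M.X k (shift ω) * (unsold η k (shift ω) - unsold η (k + 1) (shift ω))) := by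
    rw [perturbed_eq, perturbed_eq, show M.X (k + 1) ω = M.X k (shift ω) from rfl]
    ring
  rw [payoff, h₁, tsum_congr h₂, tsum_mul_left, revenue, XInf_shift, perturbed_eq, unsold_zero, X]
  ring

lemma revenue_eq (hη : IsStrategy η) (ω : ℕ → Fin n) :
    M.revenue η ω = η (ω 0) * M.state (ω 0) + (1 - η (ω 0)) * M.revenue η (shift ω) := by
  have h₁ (k : ℕ) : unsold η (k + 1) ω = (1 - η (ω 0)) * unsold η k (shift ω) := by
    rw [unsold, Finset.prod_range_succ', mul_comm]; rfl
  have h₂ : unsoldInf η ω = (1 - η (ω 0)) * unsoldInf η (shift ω) := by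
    refine tendsto_nhds_unique ((tendsto_add_atTop_iff_nat 1).2 (tendsto_unsold hη ω)) ?_
    simp_rw [h₁]
    exact (tendsto_unsold hη (shift ω)).const_mul _
  rw [revenue, (M.summable_revenueTerm hη ω).tsum_eq_zero_add]
  simp_rw [h₁, unsold_zero, h₂]
  rw [revenue, XInf_shift, X, mul_add, ← tsum_mul_left]
  have h₃ : ∀ k, M.X (k + 1) ω *
      ((1 - η (ω 0)) * unsold η k (shift ω) - (1 - η (ω 0)) * unsold η (k + 1) (shift ω)) =
      (1 - η (ω 0)) * (M.X k (shift ω) * (unsold η k (shift ω) - unsold η (k + 1) (shift ω))) := by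
    intro k
    rw [show M.X (k + 1) ω = M.X k (shift ω) from rfl]
    ring
  rw [tsum_congr h₃]
  ring

lemma measurable_revenue (hη : IsStrategy η) : Measurable (M.revenue η) := by
  have h (k : ℕ) : Measurable fun ω ↦ M.X k ω * (unsold η k ω - unsold η (k + 1) ω) :=
    (M.measurable_X k).mul ((measurable_unsold η k).sub (measurable_unsold η (k + 1)))
  have h₁ : Measurable fun ω ↦ ∑' k, M.X k ω * (unsold η k ω - unsold η (k + 1) ω) := by
    refine measurable_of_tendsto_metrizable
      (f := fun N ω ↦ ∑ k ∈ Finset.range N, M.X k ω * (unsold η k ω - unsold η (k + 1) ω))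
      (fun N ↦ Finset.measurable_fun_sum _ fun k _ ↦ h k) (tendsto_pi_nhds.2 fun ω ↦ ?_)
    exact (M.summable_revenueTerm hη ω).hasSum.tendsto_sum_nat
  have h₂ : Measurable M.XInf :=
    (StronglyMeasurable.limUnder fun k ↦ (M.measurable_X k).stronglyMeasurable).measurable
  exact h₁.add (h₂.mul (Measurable.iInf fun k ↦ measurable_unsold η k))

lemma abs_XInf_le {ω : ℕ → Fin n} (h : ∃ l : ℝ, Tendsto (fun k ↦ M.X k ω) atTop (𝓝 l)) :
    |M.XInf ω| ≤ M.bound :=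
  le_of_tendsto (tendsto_nhds_limUnder h).abs (Eventually.of_forall fun k ↦ M.abs_X_le k ω)

/-- The proportions sold and the proportion never sold add up to one, so the payoff is a weighted
average of values of the chain and its limit. Convergence is needed only to bound `XInf`. -/
lemma abs_revenue_le (hη : IsStrategy η) {ω : ℕ → Fin n}
    (h : ∃ l : ℝ, Tendsto (fun k ↦ M.X k ω) atTop (𝓝 l)) : |M.revenue η ω| ≤ M.bound := by
  have h₁ := tsum_of_norm_bounded ((hasSum_unsold_sub hη ω).mul_left M.bound)
    (M.norm_revenueTerm_le hη ω)
  have h₂ : |M.XInf ω * unsoldInf η ω| ≤ M.bound * unsoldInf η ω := by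
    rw [abs_mul, abs_of_nonneg (unsoldInf_mem hη ω).1]
    exact mul_le_mul_of_nonneg_right (M.abs_XInf_le h) (unsoldInf_mem hη ω).1
  calc |M.revenue η ω| ≤ M.bound * (1 - unsoldInf η ω) + M.bound * unsoldInf η ω :=
        (abs_add_le _ _).trans (add_le_add h₁ h₂)
    _ = M.bound := by ring

variable {M}

lemma memLp_revenue (hM : M.Converges) (hη : IsStrategy η) (x : Fin n) :
    MemLp (M.revenue η) 2 (M.pathLaw x) :=
  MemLp.of_bound (M.measurable_revenue hη).aestronglyMeasurable M.bound <| by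
    filter_upwards [hM x] with ω hω using M.abs_revenue_le hη hω

lemma integrable_revenue (hM : M.Converges) (hη : IsStrategy η) (x : Fin n) :
    Integrable (M.revenue η) (M.pathLaw x) :=
  (memLp_revenue hM hη x).integrable (by norm_num)

lemma integrable_revenue_sq (hM : M.Converges) (hη : IsStrategy η) (x : Fin n) :
    Integrable (fun ω ↦ M.revenue η ω ^ 2) (M.pathLaw x) :=
  (memLp_revenue hM hη x).integrable_sq

variable (M)

/-! ### One-step equations for the moments and the equilibrium conditions. -/

/-- The mean of the payoff of `θ^η`, as a function of the initial state. -/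
def mean (η : Fin n → ℝ) (x : Fin n) : ℝ := ∫ ω, M.revenue η ω ∂(M.pathLaw x)

/-- The second moment of the payoff of `θ^η`, as a function of the initial state. -/
def secondMoment (η : Fin n → ℝ) (x : Fin n) : ℝ :=
  ∫ ω, M.revenue η ω ^ 2 ∂(M.pathLaw x)

/-- The mean of the payoff of `θ^{0 ⊗ η}`. -/
def waitMean (η : Fin n → ℝ) (x : Fin n) : ℝ := ∑ j, M.trans x j * M.mean η j

/-- The second moment of the payoff of `θ^{0 ⊗ η}`. -/
def waitSecond (η : Fin n → ℝ) (x : Fin n) : ℝ :=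
  ∑ j, M.trans x j * M.secondMoment η j

/-- The value of `θ^{0 ⊗ η}`. -/
def waitValue (c : ℝ) (η : Fin n → ℝ) (x : Fin n) : ℝ :=
  M.waitMean η x - c * √(M.waitSecond η x - M.waitMean η x ^ 2)

variable {M}

lemma memLp_revenue_shift (hM : M.Converges) (hη : IsStrategy η) (x : Fin n) :
    MemLp (fun ω ↦ M.revenue η (shift ω)) 2 (M.pathLaw x) :=
  MemLp.of_bound ((M.measurable_revenue hη).comp measurable_shift).aestronglyMeasurable M.bound <| by
    filter_upwards [hM x] with ω ⟨l, hl⟩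
    exact M.abs_revenue_le hη ⟨l, (tendsto_add_atTop_iff_nat 1).2 hl⟩

lemma integral_revenue_shift (hM : M.Converges) (hη : IsStrategy η) (x : Fin n) :
    ∫ ω, M.revenue η (shift ω) ∂(M.pathLaw x) = M.waitMean η x :=
  M.integral_comp_shift x (M.measurable_revenue hη) (integrable_revenue hM hη)

lemma integral_revenue_shift_sq (hM : M.Converges) (hη : IsStrategy η) (x : Fin n) :
    ∫ ω, M.revenue η (shift ω) ^ 2 ∂(M.pathLaw x) = M.waitSecond η x :=
  M.integral_comp_shift x ((M.measurable_revenue hη).pow_const 2) (integrable_revenue_sq hM hη)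

lemma ae_revenue_eq (hη : IsStrategy η) (x : Fin n) : ∀ᵐ ω ∂(M.pathLaw x),
    M.revenue η ω = η x * M.state x + (1 - η x) * M.revenue η (shift ω) := by
  filter_upwards [M.ae_zero x] with ω hω
  rw [M.revenue_eq hη, hω]

lemma integral_const_add_mul {Ω : Type*} [MeasurableSpace Ω] {μ : Measure Ω}
    [IsProbabilityMeasure μ] {f : Ω → ℝ} (hf : Integrable f μ) (a b : ℝ) :
    ∫ ω, (a + b * f ω) ∂μ = a + b * ∫ ω, f ω ∂μ := by
  rw [integral_add (integrable_const a) (hf.const_mul b), integral_const, integral_const_mul]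
  simp

lemma mean_eq (hM : M.Converges) (hη : IsStrategy η) (x : Fin n) :
    M.mean η x = η x * M.state x + (1 - η x) * M.waitMean η x := by
  have hi := (memLp_revenue_shift hM hη x).integrable (by norm_num)
  rw [mean, integral_congr_ae (ae_revenue_eq hη x),
    integral_const_add_mul hi, integral_revenue_shift hM hη]

lemma secondMoment_eq (hM : M.Converges) (hη : IsStrategy η) (x : Fin n) :
    M.secondMoment η x = η x ^ 2 * M.state x ^ 2 +
      2 * η x * (1 - η x) * M.state x * M.waitMean η x + (1 - η x) ^ 2 * M.waitSecond η x := by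
  have hi := (memLp_revenue_shift hM hη x).integrable (by norm_num)
  have hi₂ := (memLp_revenue_shift hM hη x).integrable_sq
  have h : ∀ᵐ ω ∂(M.pathLaw x), M.revenue η ω ^ 2 = (η x ^ 2 * M.state x ^ 2 +
      2 * η x * (1 - η x) * M.state x * M.revenue η (shift ω)) +
        (1 - η x) ^ 2 * M.revenue η (shift ω) ^ 2 := by
    filter_upwards [ae_revenue_eq hη x] with ω hω
    rw [hω]; ring
  rw [secondMoment, integral_congr_ae h,
    integral_add (f := fun ω ↦ _ + _ * M.revenue η (shift ω))
      ((integrable_const _).add (hi.const_mul _)) (hi₂.const_mul _),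
    integral_const_add_mul hi, integral_const_mul, integral_revenue_shift hM hη,
    integral_revenue_shift_sq hM hη]

/-- Given the starting state, only the shifted payoff is random; it carries the factor `1 - ξ x ≥
0`, which comes out of the standard deviation unchanged. -/
lemma objective_perturbed (hM : M.Converges) (c : ℝ) {ξ : Fin n → ℝ} (hξ : IsStrategy ξ)
    (hη : IsStrategy η) (x : Fin n) :
    M.objective c x (perturbed ξ η) = ξ x * M.state x + (1 - ξ x) * M.waitValue c η x := by
  have hL := memLp_revenue_shift hM hη x
  have h : M.payoff (perturbed ξ η) =ᵐ[M.pathLaw x]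
      fun ω ↦ ξ x * M.state x + (1 - ξ x) * M.revenue η (shift ω) := by
    filter_upwards [M.ae_zero x] with ω hω
    rw [M.payoff_perturbed ξ hη, hω]
  have hv : variance (M.payoff (perturbed ξ η)) (M.pathLaw x) =
      (1 - ξ x) ^ 2 * (M.waitSecond η x - M.waitMean η x ^ 2) := by
    rw [variance_congr h, variance_const_add (hL.const_mul _).aestronglyMeasurable,
      variance_const_mul, variance_eq_sub hL, integral_revenue_shift hM hη]
    congr 2
    exact integral_revenue_shift_sq hM hη x
  rw [objective, hv, integral_congr_ae h,
    integral_const_add_mul (hL.integrable (by norm_num)), integral_revenue_shift hM hη,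
    Real.sqrt_mul (sq_nonneg _), Real.sqrt_sq (sub_nonneg.2 (hξ x).2), waitValue]
  ring

lemma objective_homogeneous (hM : M.Converges) (c : ℝ) (hη : IsStrategy η) (x : Fin n) :
    M.objective c x (homogeneous η) = η x * M.state x + (1 - η x) * M.waitValue c η x := by
  rw [homogeneous_eq, objective_perturbed hM c hη hη]

/-- An affine function of `ξ x` on `[0,1]` is maximal at `η x` iff its slope has the right sign;
testing `ξ = 1` and `ξ = 0` suffices. -/
lemma isEquilibrium_iff (hM : M.Converges) (c : ℝ) :
    M.IsEquilibrium c η ↔ IsStrategy η ∧ ∀ x, (η x < 1 → M.state x ≤ M.waitValue c η x) ∧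
      (0 < η x → M.waitValue c η x ≤ M.state x) := by
  refine and_congr_right fun hη ↦ ⟨fun h x ↦ ⟨fun hx ↦ ?_, fun hx ↦ ?_⟩, fun h ξ hξ x ↦ ?_⟩
  · have h₁ : IsStrategy fun _ : Fin n ↦ (1 : ℝ) := fun _ ↦ by simp
    have := h _ h₁ x
    rw [objective_perturbed hM c h₁ hη, objective_perturbed hM c hη hη] at this
    nlinarith
  · have h₁ : IsStrategy fun _ : Fin n ↦ (0 : ℝ) := fun _ ↦ by simp
    have := h _ h₁ x
    rw [objective_perturbed hM c h₁ hη, objective_perturbed hM c hη hη] at this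
    nlinarith
  · rw [objective_perturbed hM c hξ hη, objective_perturbed hM c hη hη]
    obtain ⟨h₁, h₂⟩ := h x
    obtain ⟨hξ₀, hξ₁⟩ := hξ x
    obtain ⟨hη₀, hη₁⟩ := hη x
    rcases le_total (M.state x) (M.waitValue c η x) with hle | hle
    -- Complementary slackness: a strictly positive gain from waiting excludes any selling at `x`.
    · have : η x * (M.waitValue c η x - M.state x) = 0 := by
        rcases hη₀.eq_or_lt with h0 | h0
        · rw [← h0, zero_mul]
        · rw [le_antisymm (h₂ h0) hle, sub_self, mul_zero]
      nlinarith [mul_nonneg hξ₀ (sub_nonneg.2 hle)]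
    · have : (1 - η x) * (M.waitValue c η x - M.state x) = 0 := by
        rcases hη₁.eq_or_lt with h0 | h0
        · rw [h0, sub_self, zero_mul]
        · rw [le_antisymm hle (h₁ h0), sub_self, mul_zero]
      nlinarith [mul_nonneg (sub_nonneg.2 hξ₁) (sub_nonneg.2 hle)]

lemma Absorbing.ae_revenue {x : Fin n} (h : M.Absorbing x) (hη : IsStrategy η) :
    ∀ᵐ ω ∂(M.pathLaw x), M.revenue η ω = M.state x := by
  filter_upwards [h.ae_eq] with ω hω
  have h₁ (k : ℕ) : M.X k ω = M.state x := by rw [X, hω]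
  have h₂ : M.XInf ω = M.state x := by
    simp only [XInf, h₁]
    exact tendsto_const_nhds.limUnder_eq
  simp only [revenue, h₁, h₂, tsum_mul_left, (hasSum_unsold_sub hη ω).tsum_eq]
  ring

lemma Absorbing.mean_eq {x : Fin n} (h : M.Absorbing x) (hη : IsStrategy η) :
    M.mean η x = M.state x := by
  rw [mean, integral_congr_ae (h.ae_revenue hη)]
  simp

lemma Absorbing.secondMoment_eq {x : Fin n} (h : M.Absorbing x) (hη : IsStrategy η) :
    M.secondMoment η x = M.state x ^ 2 := by
  have := (h.ae_revenue hη).mono fun ω hω ↦ congrArg (· ^ 2) hω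
  rw [secondMoment, integral_congr_ae this]
  simp

lemma Absorbing.waitValue_eq {x : Fin n} (h : M.Absorbing x) (hη : IsStrategy η) (c : ℝ) :
    M.waitValue c η x = M.state x := by
  rw [waitValue, waitMean, waitSecond, h.sum_mul, h.sum_mul, h.mean_eq hη, h.secondMoment_eq hη]
  simp

lemma waitMean_sq_le (hM : M.Converges) (hη : IsStrategy η) (x : Fin n) :
    M.waitMean η x ^ 2 ≤ M.waitSecond η x := by
  have h := variance_eq_sub (memLp_revenue_shift hM hη x)
  rw [integral_revenue_shift hM hη] at h
  have h₂ : ∫ ω, ((fun ω ↦ M.revenue η (shift ω)) ^ 2) ω ∂(M.pathLaw x) = M.waitSecond η x :=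
    integral_revenue_shift_sq hM hη x
  rw [h₂] at h
  linarith [variance_nonneg (fun ω ↦ M.revenue η (shift ω)) (M.pathLaw x)]

end FiniteChain

end revenue

/-! ### Reduction of the equilibrium conditions to moment inequalities. -/

namespace FiniteChain

variable {n : ℕ} {M : FiniteChain n} {η : Fin n → ℝ}

lemma isEquilibrium_iff_of_not_absorbing (hM : M.Converges) (c : ℝ) :
    M.IsEquilibrium c η ↔ IsStrategy η ∧ ∀ x, ¬ M.Absorbing x →
      (η x < 1 → M.state x ≤ M.waitValue c η x) ∧
        (0 < η x → M.waitValue c η x ≤ M.state x) := by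
  rw [isEquilibrium_iff hM]
  refine and_congr_right fun hη ↦ ⟨fun h x _ ↦ h x, fun h x ↦ ?_⟩
  by_cases hx : M.Absorbing x
  · rw [hx.waitValue_eq hη]; simp
  · exact h x hx

lemma Absorbing.objective_eq {x : Fin n} (h : M.Absorbing x) (hM : M.Converges)
    (hη : IsStrategy η) (c : ℝ) : M.objective c x (homogeneous η) = M.state x := by
  rw [objective_homogeneous hM c hη, h.waitValue_eq hη]
  ring

/-- This rules out optimality of any equilibrium that sells at `x` when another one is worth more
than the state there. -/
lemma objective_le_state {c : ℝ} (hM : M.Converges) (h : M.IsEquilibrium c η) {x : Fin n}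
    (hx : 0 < η x) : M.objective c x (homogeneous η) ≤ M.state x := by
  have hη := h.1
  rw [objective_homogeneous hM c hη]
  nlinarith [((isEquilibrium_iff hM c).1 h).2 x |>.2 hx, (hη x).2]

lemma objective_of_eq_zero {c : ℝ} (hM : M.Converges) (hη : IsStrategy η) {x : Fin n}
    (hx : η x = 0) : M.objective c x (homogeneous η) = M.waitValue c η x := by
  rw [objective_homogeneous hM c hη, hx]
  ring

lemma objective_of_eq_one {c : ℝ} (hM : M.Converges) (hη : IsStrategy η) {x : Fin n}
    (hx : η x = 1) : M.objective c x (homogeneous η) = M.state x := by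
  rw [objective_homogeneous hM c hη, hx]
  ring

section centred

-- Here `u` and `w` are the first two moments of the shifted payoff minus the current state, so `w -
-- u ^ 2` is its variance.
variable {x : Fin n} {c u w : ℝ} (hA : M.waitMean η x = M.state x + u)
  (hB : M.waitSecond η x = M.state x ^ 2 + 2 * M.state x * u + w)
include hA hB

lemma waitValue_eq_of_centred : M.waitValue c η x = M.state x + u - c * √(w - u ^ 2) := by
  rw [waitValue, hA, hB]
  ring_nf

lemma sq_le_of_centred (hM : M.Converges) (hη : IsStrategy η) : u ^ 2 ≤ w := by
  have := waitMean_sq_le hM hη x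
  rw [hA, hB] at this
  linarith

lemma waitValue_le_iff (hM : M.Converges) (hη : IsStrategy η) (hc : 0 ≤ c) (hu : 0 ≤ u) :
    M.waitValue c η x ≤ M.state x ↔ (1 + c ^ 2) * u ^ 2 ≤ c ^ 2 * w := by
  have h := sub_nonneg.2 (sq_le_of_centred hA hB hM hη)
  rw [waitValue_eq_of_centred hA hB, ← Real.sqrt_sq hc, ← Real.sqrt_mul (sq_nonneg c),
    Real.sqrt_sq hc]
  rw [show M.state x + u - √(c ^ 2 * (w - u ^ 2)) ≤ M.state x ↔ u ≤ √(c ^ 2 * (w - u ^ 2)) by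
    constructor <;> intro h <;> linarith, Real.le_sqrt hu (mul_nonneg (sq_nonneg c) h)]
  constructor <;> intro h <;> linarith

lemma le_waitValue_iff (hc : 0 ≤ c) (hu : 0 ≤ u) :
    M.state x ≤ M.waitValue c η x ↔ c ^ 2 * w ≤ (1 + c ^ 2) * u ^ 2 := by
  rw [waitValue_eq_of_centred hA hB, ← Real.sqrt_sq hc, ← Real.sqrt_mul (sq_nonneg c),
    Real.sqrt_sq hc]
  rw [show M.state x ≤ M.state x + u - √(c ^ 2 * (w - u ^ 2)) ↔ √(c ^ 2 * (w - u ^ 2)) ≤ u by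
    constructor <;> intro h <;> linarith, Real.sqrt_le_left hu]
  constructor <;> intro h <;> linarith

end centred

end FiniteChain

/-- The polynomial in `1 - a` is positive at `a = 1` and negative at `a = 0`, so it has an interior
root; convexity makes it unique. Its sign says whether selling or waiting is preferred, so both
endpoints are self-consistent. -/
lemma exists_best_response {α β γ : ℝ} (hα : 0 ≤ α) (h₀ : 0 < γ) (h₁ : α + β + γ < 0) :
    ∃ b ∈ Set.Ioo (0 : ℝ) 1, α * (1 - b) ^ 2 + β * (1 - b) + γ = 0 ∧ ∀ a ∈ Set.Icc (0 : ℝ) 1,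
      ((a < 1 → α * (1 - a) ^ 2 + β * (1 - a) + γ ≤ 0) ∧
        (0 < a → 0 ≤ α * (1 - a) ^ 2 + β * (1 - a) + γ)) ↔ a = 0 ∨ a = b ∨ a = 1 := by
  have hc : ContinuousOn (fun b : ℝ ↦ α * (1 - b) ^ 2 + β * (1 - b) + γ) (Set.Icc 0 1) := by
    fun_prop
  obtain ⟨b, hb, hF⟩ := intermediate_value_Ioo zero_le_one hc
    (show (0 : ℝ) ∈ Set.Ioo _ _ from ⟨by simpa using h₁, by simpa using h₀⟩)
  simp only at hF
  obtain ⟨hb₀, hb₁⟩ := hb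
  -- The secant slope between the root and `a = 0`; by convexity it bounds the cofactor in `hfac`
  -- for every `a ≥ 0`.
  have hslope : α * (1 + (1 - b)) + β < 0 := by
    by_contra! h
    nlinarith [mul_nonneg hb₀.le h]
  have hfac (a : ℝ) : α * (1 - a) ^ 2 + β * (1 - a) + γ =
      (b - a) * (α * ((1 - a) + (1 - b)) + β) := by
    linear_combination hF
  refine ⟨b, ⟨hb₀, hb₁⟩, hF, fun a ⟨ha₀, ha₁⟩ ↦ ?_⟩
  have hneg : α * ((1 - a) + (1 - b)) + β < 0 := by nlinarith [mul_nonneg hα ha₀]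
  rw [hfac]
  constructor
  · rintro ⟨h, h'⟩
    rcases ha₀.eq_or_lt with h0 | h0
    · exact Or.inl h0.symm
    rcases ha₁.eq_or_lt with h1 | h1
    · exact Or.inr (Or.inr h1)
    refine Or.inr (Or.inl ?_)
    have := le_antisymm (h h1) (h' h0)
    rcases mul_eq_zero.1 this with h | h
    · linarith
    · exact (hneg.ne h).elim
  · rintro (rfl | rfl | rfl)
    · exact ⟨fun _ ↦ mul_nonpos_of_nonneg_of_nonpos (by linarith) hneg.le,
        fun h ↦ (lt_irrefl _ h).elim⟩
    · simp
    · exact ⟨fun h ↦ (lt_irrefl _ h).elim,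
        fun _ ↦ mul_nonneg_of_nonpos_of_nonpos (by linarith) hneg.le⟩

/-! ### The chain on {0, 1, 4}. -/

section chainC

open FiniteChain

variable {η : Fin 3 → ℝ}

lemma chainC_sum (f : Fin 3 → ℝ) :
    ∑ j, chainC.trans 1 j * f j = 1 / 10 * f 0 + 4 / 5 * f 1 + 1 / 10 * f 2 := by
  simp [Fin.sum_univ_three, chainC]

lemma chainC_absorbing_zero : chainC.Absorbing 0 := by simp [Absorbing, chainC]

lemma chainC_absorbing_two : chainC.Absorbing 2 := by simp [Absorbing, chainC]

lemma chainC_not_absorbing_one : ¬ chainC.Absorbing 1 := by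
  norm_num [Absorbing, chainC]

lemma chainC_converges : chainC.Converges := by
  rw [converges_iff]
  have h := chainC.divergenceProb_eq_sum 1
  rw [chainC_sum, chainC_absorbing_zero.divergenceProb, chainC_absorbing_two.divergenceProb] at h
  intro x
  fin_cases x
  · exact chainC_absorbing_zero.divergenceProb
  · change chainC.divergenceProb 1 = 0
    linarith
  · exact chainC_absorbing_two.divergenceProb

lemma chainC_wait (hη : IsStrategy η) : ∃ u w : ℝ,
    chainC.waitMean η 1 = chainC.state 1 + u ∧
    chainC.waitSecond η 1 = chainC.state 1 ^ 2 + 2 * chainC.state 1 * u + w ∧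
    u * (1 - 4 / 5 * (1 - η 1)) = 1 / 5 ∧ w * (1 - 4 / 5 * (1 - η 1) ^ 2) = 1 := by
  have s₀ : chainC.state 0 = 0 := rfl
  have s₁ : chainC.state 1 = 1 := rfl
  have s₂ : chainC.state 2 = 4 := rfl
  have hA := chainC_sum (chainC.mean η)
  have hB := chainC_sum (chainC.secondMoment η)
  rw [chainC_absorbing_zero.mean_eq hη, chainC_absorbing_two.mean_eq hη,
    FiniteChain.mean_eq chainC_converges hη, ← waitMean, s₀, s₁, s₂] at hA
  rw [chainC_absorbing_zero.secondMoment_eq hη, chainC_absorbing_two.secondMoment_eq hη,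
    FiniteChain.secondMoment_eq chainC_converges hη, ← waitSecond, s₀, s₁, s₂] at hB
  refine ⟨chainC.waitMean η 1 - 1, chainC.waitSecond η 1 - 2 * chainC.waitMean η 1 + 1, ?_, ?_,
    ?_, ?_⟩
  · rw [s₁]; ring
  · rw [s₁]; ring
  · linear_combination hA
  · linear_combination hB - 2 * hA

/-- After clearing denominators the difference of the two sides is `-(1/5) * (η 1)²`: a double root
at `η 1 = 0`. -/
lemma chainC_le_iff (hη : IsStrategy η) :
    (chainC.waitValue (1 / 2) η 1 ≤ chainC.state 1) ∧
      (chainC.state 1 ≤ chainC.waitValue (1 / 2) η 1 ↔ η 1 = 0) := by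
  obtain ⟨u, w, hA, hB, hu, hw⟩ := chainC_wait hη
  obtain ⟨h₀, h₁⟩ := hη 1
  set a := η 1
  have hp : 0 < 1 - 4 / 5 * (1 - a) := by linarith
  have hq : 0 < 1 - 4 / 5 * (1 - a) ^ 2 := by nlinarith
  have hu₀ : 0 ≤ u := by
    by_contra! h
    nlinarith
  rw [waitValue_le_iff hA hB chainC_converges hη (by norm_num) hu₀,
    le_waitValue_iff hA hB (by norm_num) hu₀]
  have e : ((1 + (1 / 2 : ℝ) ^ 2) * u ^ 2 - (1 / 2) ^ 2 * w) *
      ((1 - 4 / 5 * (1 - a)) ^ 2 * (1 - 4 / 5 * (1 - a) ^ 2)) = -(1 / 5) * a ^ 2 := by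
    linear_combination (5 / 4 * (1 - 4 / 5 * (1 - a) ^ 2)) *
      (u * (1 - 4 / 5 * (1 - a)) + 1 / 5) * hu - (1 / 4 * (1 - 4 / 5 * (1 - a)) ^ 2) * hw
  have hpos : 0 < (1 - 4 / 5 * (1 - a)) ^ 2 * (1 - 4 / 5 * (1 - a) ^ 2) := by positivity
  refine ⟨?_, fun h ↦ ?_, fun h ↦ ?_⟩
  · by_contra! h
    nlinarith [mul_pos (sub_pos.2 h) hpos, sq_nonneg a]
  · have := mul_nonneg (sub_nonneg.2 h) hpos.le
    rw [e] at this
    exact pow_eq_zero_iff two_ne_zero |>.1 (le_antisymm (by linarith) (sq_nonneg a))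
  · rw [h] at e hpos
    have := (mul_eq_zero.1 (e.trans (by norm_num))).resolve_right hpos.ne'
    linarith

lemma chainC_isEquilibrium_iff :
    chainC.IsEquilibrium (1 / 2) η ↔ IsStrategy η ∧ (η 1 = 0 ∨ η 1 = 1) := by
  rw [isEquilibrium_iff_of_not_absorbing chainC_converges]
  refine and_congr_right fun hη ↦ ?_
  obtain ⟨h, h'⟩ := chainC_le_iff hη
  constructor
  · intro H
    rcases (hη 1).2.eq_or_lt with h1 | h1
    · exact Or.inr h1
    · exact Or.inl (h'.1 ((H 1 chainC_not_absorbing_one).1 h1))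
  · intro H x hx
    fin_cases x
    · exact (hx chainC_absorbing_zero).elim
    · refine ⟨fun h1 ↦ h'.2 (H.resolve_right (ne_of_lt h1)), fun _ ↦ h⟩
    · exact (hx chainC_absorbing_two).elim

lemma chainC_equilibria : chainC.equilibria (1 / 2) = {![1, 0, 1], ![1, 1, 1]} := by
  ext η
  simp only [equilibria, Set.mem_ofPred_eq, chainC_isEquilibrium_iff, Set.mem_insert_iff,
    Set.mem_singleton_iff]
  constructor
  · rintro ⟨⟨-, h⟩, hη⟩
    have h₀ := hη 0 chainC_absorbing_zero
    have h₂ := hη 2 chainC_absorbing_two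
    refine h.imp ?_ ?_ <;>
    · intro h
      ext x
      fin_cases x <;> simp [h₀, h₂, h]
  · rintro (rfl | rfl) <;> refine ⟨⟨fun x ↦ ?_, by simp⟩, fun x hx ↦ ?_⟩ <;> fin_cases x <;>
      first
      | simp; done
      | exact (chainC_not_absorbing_one hx).elim

/-- Selling yields the state, and never selling yields the same because of the tie at `η 1 = 0`.
Hence all equilibria have equal values. -/
lemma chainC_objective (h : chainC.IsEquilibrium (1 / 2) η) (x : Fin 3) :
    chainC.objective (1 / 2) x (homogeneous η) = chainC.state x := by
  obtain ⟨hη, h'⟩ := chainC_isEquilibrium_iff.1 h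
  fin_cases x
  · exact chainC_absorbing_zero.objective_eq chainC_converges hη _
  · change chainC.objective (1 / 2) 1 (homogeneous η) = chainC.state 1
    rcases h' with h0 | h1
    · rw [objective_of_eq_zero chainC_converges hη h0]
      exact le_antisymm (chainC_le_iff hη).1 ((chainC_le_iff hη).2.2 h0)
    · exact objective_of_eq_one chainC_converges hη h1
  · exact chainC_absorbing_two.objective_eq chainC_converges hη _

lemma chainC_isOptimal (h : chainC.IsEquilibrium (1 / 2) η) : chainC.IsOptimal (1 / 2) η :=
  ⟨h, fun _ h' x ↦ by rw [chainC_objective h, chainC_objective h']⟩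

lemma chainC_ncard : (chainC.equilibria (1 / 2)).ncard = 2 := by
  rw [chainC_equilibria, Set.ncard_pair]
  intro h
  simpa using congrFun h 1

end chainC

/-! ### The chain on {0, 1, 2, 7, 9}. -/

section chainA

open FiniteChain

variable {η : Fin 5 → ℝ}

lemma chainA_sum_one (f : Fin 5 → ℝ) :
    ∑ j, chainA.trans 1 j * f j = 1 / 5 * f 0 + 2 / 5 * f 2 + 1 / 5 * f 3 + 1 / 5 * f 4 := by
  simp [Fin.sum_univ_five, chainA]

lemma chainA_sum_three (f : Fin 5 → ℝ) :
    ∑ j, chainA.trans 3 j * f j = 1 / 5 * f 1 + 4 / 5 * f 4 := by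
  simp [Fin.sum_univ_five, chainA]

lemma chainA_absorbing_zero : chainA.Absorbing 0 := by simp [Absorbing, chainA]

lemma chainA_absorbing_two : chainA.Absorbing 2 := by simp [Absorbing, chainA]

lemma chainA_absorbing_four : chainA.Absorbing 4 := by simp [Absorbing, chainA]

lemma chainA_not_absorbing_one : ¬ chainA.Absorbing 1 := by norm_num [Absorbing, chainA]

lemma chainA_not_absorbing_three : ¬ chainA.Absorbing 3 := fun h ↦ zero_ne_one (α := ℝ) h

lemma chainA_converges : chainA.Converges := by
  rw [converges_iff]
  have h := chainA.divergenceProb_eq_sum 1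
  have h' := chainA.divergenceProb_eq_sum 3
  rw [chainA_sum_one, chainA_absorbing_zero.divergenceProb, chainA_absorbing_two.divergenceProb,
    chainA_absorbing_four.divergenceProb] at h
  rw [chainA_sum_three, chainA_absorbing_four.divergenceProb] at h'
  intro x
  fin_cases x
  · exact chainA_absorbing_zero.divergenceProb
  · change chainA.divergenceProb 1 = 0
    linarith
  · exact chainA_absorbing_two.divergenceProb
  · change chainA.divergenceProb 3 = 0
    linarith
  · exact chainA_absorbing_four.divergenceProb

lemma chainA_wait (hη : IsStrategy η) : ∃ u w p q : ℝ,
    chainA.waitMean η 1 = chainA.state 1 + u ∧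
    chainA.waitSecond η 1 = chainA.state 1 ^ 2 + 2 * chainA.state 1 * u + w ∧
    chainA.waitMean η 3 = chainA.state 3 + p ∧
    chainA.waitSecond η 3 = chainA.state 3 ^ 2 + 2 * chainA.state 3 * p + q ∧
    u = 3 + 1 / 5 * (1 - η 3) * p ∧
    w = 103 / 5 + 12 / 5 * (1 - η 3) * p + 1 / 5 * (1 - η 3) ^ 2 * q ∧
    p = 2 / 5 + 1 / 5 * (1 - η 1) * u ∧
    q = 52 / 5 - 12 / 5 * (1 - η 1) * u + 1 / 5 * (1 - η 1) ^ 2 * w := by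
  have s₀ : chainA.state 0 = 0 := rfl
  have s₁ : chainA.state 1 = 1 := rfl
  have s₂ : chainA.state 2 = 2 := rfl
  have s₃ : chainA.state 3 = 7 := rfl
  have s₄ : chainA.state 4 = 9 := rfl
  have hA := chainA_sum_one (chainA.mean η)
  have hB := chainA_sum_one (chainA.secondMoment η)
  have hA' := chainA_sum_three (chainA.mean η)
  have hB' := chainA_sum_three (chainA.secondMoment η)
  rw [chainA_absorbing_zero.mean_eq hη, chainA_absorbing_two.mean_eq hη,
    chainA_absorbing_four.mean_eq hη, FiniteChain.mean_eq chainA_converges hη, ← waitMean,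
    s₀, s₂, s₃, s₄] at hA
  rw [chainA_absorbing_zero.secondMoment_eq hη, chainA_absorbing_two.secondMoment_eq hη,
    chainA_absorbing_four.secondMoment_eq hη, FiniteChain.secondMoment_eq chainA_converges hη,
    ← waitSecond, s₀, s₂, s₃, s₄] at hB
  rw [chainA_absorbing_four.mean_eq hη, FiniteChain.mean_eq chainA_converges hη, ← waitMean,
    s₁, s₄] at hA'
  rw [chainA_absorbing_four.secondMoment_eq hη, FiniteChain.secondMoment_eq chainA_converges hη,
    ← waitSecond, s₁, s₄] at hB'
  refine ⟨chainA.waitMean η 1 - 1, chainA.waitSecond η 1 - 2 * chainA.waitMean η 1 + 1,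
    chainA.waitMean η 3 - 7, chainA.waitSecond η 3 - 14 * chainA.waitMean η 3 + 49,
    ?_, ?_, ?_, ?_, ?_, ?_, ?_, ?_⟩
  · rw [s₁]; ring
  · rw [s₁]; ring
  · rw [s₃]; ring
  · rw [s₃]; ring
  · linear_combination hA
  · linear_combination hB - 2 * hA
  · linear_combination hA'
  · linear_combination hB' - 14 * hA'

/-- Here `t` and `s` are the unsold fractions at 1 and 7, and `29/4 = (1 + c²) / c²` for `c = 2/5`.
The last inequality says that waiting at 1 is strictly better; crude bounds suffice, as `u ≥ 3`
while `w` stays below 30. -/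
lemma chainA_bound {u w p q t s : ℝ} (ht : t ∈ Set.Icc (0 : ℝ) 1) (hs : s ∈ Set.Icc (0 : ℝ) 1)
    (hu : u = 3 + 1 / 5 * s * p) (hw : w = 103 / 5 + 12 / 5 * s * p + 1 / 5 * s ^ 2 * q)
    (hp : p = 2 / 5 + 1 / 5 * t * u) (hq : q = 52 / 5 - 12 / 5 * t * u + 1 / 5 * t ^ 2 * w)
    (hw₀ : 0 ≤ w) (hq₀ : 0 ≤ q) : 0 ≤ p ∧ 3 ≤ u ∧ w < 29 / 4 * u ^ 2 := by
  obtain ⟨ht₀, ht₁⟩ := ht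
  obtain ⟨hs₀, hs₁⟩ := hs
  have hts₀ : 0 ≤ t * s := mul_nonneg ht₀ hs₀
  have hts₁ : t * s ≤ 1 := mul_le_one₀ ht₁ hs₀ hs₁
  have hp' : p * (1 - 1 / 25 * (t * s)) = 2 / 5 + 3 / 5 * t := by
    linear_combination hp + 1 / 5 * t * hu
  have hp₀ : 0 ≤ p := by
    by_contra! h
    have := mul_neg_of_neg_of_pos h (show 0 < 1 - 1 / 25 * (t * s) by linarith)
    linarith
  have hp₁ : p ≤ 2 := by
    have := mul_le_mul_of_nonneg_left hts₁ hp₀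
    linarith
  have hsp₀ : 0 ≤ s * p := mul_nonneg hs₀ hp₀
  have hsp : s * p ≤ p := mul_le_of_le_one_left hp₀ hs₁
  have hu₃ : 3 ≤ u := by linarith
  have htu : 0 ≤ t * u := mul_nonneg ht₀ (by linarith)
  have htw : t ^ 2 * w ≤ w := mul_le_of_le_one_left hw₀ (pow_le_one₀ ht₀ ht₁)
  have hsq : s ^ 2 * q ≤ q := mul_le_of_le_one_left hq₀ (pow_le_one₀ hs₀ hs₁)
  have hu₉ : 3 ^ 2 ≤ u ^ 2 := pow_le_pow_left₀ (by norm_num) hu₃ 2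
  exact ⟨hp₀, hu₃, by linarith⟩

lemma one_sub_mem_Icc {n : ℕ} {η : Fin n → ℝ} (hη : IsStrategy η) (x : Fin n) :
    1 - η x ∈ Set.Icc (0 : ℝ) 1 :=
  ⟨sub_nonneg.2 (hη x).2, sub_le_self 1 (hη x).1⟩

lemma chainA_state_one_lt_waitValue (hη : IsStrategy η) :
    chainA.state 1 < chainA.waitValue (2 / 5) η 1 := by
  obtain ⟨u, w, p, q, hA, hB, hA', hB', hu, hw, hp, hq⟩ := chainA_wait hη
  obtain ⟨-, hu₃, h⟩ := chainA_bound (one_sub_mem_Icc hη 1) (one_sub_mem_Icc hη 3) hu hw hp hq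
    ((sq_nonneg u).trans (sq_le_of_centred hA hB chainA_converges hη))
    ((sq_nonneg p).trans (sq_le_of_centred hA' hB' chainA_converges hη))
  rw [← not_le, waitValue_le_iff hA hB chainA_converges hη (by norm_num) (by linarith)]
  linarith

/-- With `η 1 = 0` the linear system gives `p` and `q` as rational functions of `1 - η 3`; the
quadratic is what remains of `c² q - (1 + c²) p²`, up to positive factors. -/
lemma chainA_three_iff (hη : IsStrategy η) (h0 : η 1 = 0) :
    (chainA.waitValue (2 / 5) η 3 ≤ chainA.state 3 ↔
      0 ≤ 18857 / 62500 * (1 - η 3) ^ 2 + -(366 / 625) * (1 - η 3) + 7 / 100) ∧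
    (chainA.state 3 ≤ chainA.waitValue (2 / 5) η 3 ↔
      18857 / 62500 * (1 - η 3) ^ 2 + -(366 / 625) * (1 - η 3) + 7 / 100 ≤ 0) := by
  obtain ⟨u, w, p, q, hA, hB, hA', hB', hu, hw, hp, hq⟩ := chainA_wait hη
  obtain ⟨hs₀, hs₁⟩ := one_sub_mem_Icc hη 3
  obtain ⟨hp₀, -⟩ := chainA_bound (one_sub_mem_Icc hη 1) (one_sub_mem_Icc hη 3) hu hw hp hq
    ((sq_nonneg u).trans (sq_le_of_centred hA hB chainA_converges hη))
    ((sq_nonneg p).trans (sq_le_of_centred hA' hB' chainA_converges hη))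
  rw [waitValue_le_iff hA' hB' chainA_converges hη (by norm_num) hp₀,
    le_waitValue_iff hA' hB' (by norm_num) hp₀]
  rw [h0] at hp hq
  generalize 1 - η 3 = s at hu hw hs₀ hs₁ ⊢
  have hp' : p * (1 - 1 / 25 * s) = 1 := by linear_combination hp + 1 / 5 * hu
  have hq' : q * (1 - 1 / 25 * s ^ 2) = 183 / 25 := by
    linear_combination hq + 1 / 5 * hw - 12 / 5 * hu
  have e : ((2 / 5 : ℝ) ^ 2 * q - (1 + (2 / 5 : ℝ) ^ 2) * p ^ 2) *
      ((1 - 1 / 25 * s) ^ 2 * (1 - 1 / 25 * s ^ 2)) =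
      4 / 25 * (18857 / 62500 * s ^ 2 + -(366 / 625) * s + 7 / 100) := by
    linear_combination 4 / 25 * (1 - 1 / 25 * s) ^ 2 * hq' -
      29 / 25 * (1 - 1 / 25 * s ^ 2) * (p * (1 - 1 / 25 * s) + 1) * hp'
  have hpos : 0 < (1 - 1 / 25 * s) ^ 2 * (1 - 1 / 25 * s ^ 2) := by
    have : s ^ 2 ≤ 1 := pow_le_one₀ hs₀ hs₁
    exact mul_pos (pow_pos (by linarith) 2) (by linarith)
  constructor
  · rw [← sub_nonneg, ← mul_nonneg_iff_of_pos_right hpos, e,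
      mul_nonneg_iff_of_pos_left (by norm_num)]
  · rw [← neg_nonneg (a := _ + _), ← mul_nonneg_iff_of_pos_left (show (0 : ℝ) < 4 / 25 by norm_num),
      mul_neg, ← e, ← neg_mul, neg_sub, mul_nonneg_iff_of_pos_right hpos, sub_nonneg]

lemma exists_chainA_isEquilibrium_iff : ∃ b ∈ Set.Ioo (0 : ℝ) 1, 17 / 20 < b ∧
    ∀ {η : Fin 5 → ℝ}, chainA.IsEquilibrium (2 / 5) η ↔
      IsStrategy η ∧ η 1 = 0 ∧ (η 3 = 0 ∨ η 3 = b ∨ η 3 = 1) := by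
  obtain ⟨b, hb, hroot, H⟩ := exists_best_response (α := 18857 / 62500) (β := -(366 / 625))
    (γ := 7 / 100) (by norm_num) (by norm_num) (by norm_num)
  -- The quadratic is negative at unsold fractions `3/20` and `1`, hence by convexity in between, so
  -- `1 - b < 3/20`.
  refine ⟨b, hb, by nlinarith [hb.1, hb.2], fun {η} ↦ ?_⟩
  rw [isEquilibrium_iff_of_not_absorbing chainA_converges]
  refine and_congr_right fun hη ↦ ?_
  have h₁ := chainA_state_one_lt_waitValue hη
  constructor
  · intro h
    have h0 : η 1 = 0 := by
      by_contra hne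
      exact absurd ((h 1 chainA_not_absorbing_one).2 ((hη 1).1.lt_of_ne' hne)) h₁.not_ge
    have h₃ := h 3 chainA_not_absorbing_three
    rw [(chainA_three_iff hη h0).1, (chainA_three_iff hη h0).2, H _ (hη 3)] at h₃
    exact ⟨h0, h₃⟩
  · rintro ⟨h0, h₃⟩ x hx
    rw [← H _ (hη 3), ← (chainA_three_iff hη h0).1, ← (chainA_three_iff hη h0).2] at h₃
    fin_cases x
    · exact (hx chainA_absorbing_zero).elim
    · exact ⟨fun _ ↦ h₁.le, fun h ↦ (h.ne' h0).elim⟩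
    · exact (hx chainA_absorbing_two).elim
    · exact h₃
    · exact (hx chainA_absorbing_four).elim

lemma chainA_isStrategy {b : ℝ} (hb : b ∈ Set.Icc (0 : ℝ) 1) : IsStrategy ![1, 0, 1, b, 1] := by
  intro x
  fin_cases x <;> first | exact hb | simp

lemma chainA_equilibria {b : ℝ} (hb : b ∈ Set.Ioo (0 : ℝ) 1)
    (H : ∀ {η : Fin 5 → ℝ}, chainA.IsEquilibrium (2 / 5) η ↔
      IsStrategy η ∧ η 1 = 0 ∧ (η 3 = 0 ∨ η 3 = b ∨ η 3 = 1)) :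
    chainA.equilibria (2 / 5) = {![1, 0, 1, 0, 1], ![1, 0, 1, b, 1], ![1, 0, 1, 1, 1]} := by
  ext η
  simp only [equilibria, Set.mem_ofPred_eq, H, Set.mem_insert_iff, Set.mem_singleton_iff]
  constructor
  · rintro ⟨⟨-, h₁, h⟩, hη⟩
    have h₀ := hη 0 chainA_absorbing_zero
    have h₂ := hη 2 chainA_absorbing_two
    have h₄ := hη 4 chainA_absorbing_four
    refine h.imp ?_ (Or.imp ?_ ?_) <;>
    · intro h
      ext x
      fin_cases x <;> simp [h₀, h₁, h₂, h₄, h]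
  · have key (c : ℝ) (hc : c ∈ Set.Icc (0 : ℝ) 1) (h : c = 0 ∨ c = b ∨ c = 1)
        (hη : η = ![1, 0, 1, c, 1]) : (IsStrategy η ∧ η 1 = 0 ∧ (η 3 = 0 ∨ η 3 = b ∨ η 3 = 1)) ∧
        ∀ x, chainA.Absorbing x → η x = 1 := by
      subst hη
      refine ⟨⟨chainA_isStrategy hc, rfl, h⟩, fun x hx ↦ ?_⟩
      fin_cases x
      · rfl
      · exact (chainA_not_absorbing_one hx).elim
      · rfl
      · exact (chainA_not_absorbing_three hx).elim
      · rfl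
    rintro (h | h | h)
    · exact key 0 (by simp) (by simp) h
    · exact key b ⟨hb.1.le, hb.2.le⟩ (by simp) h
    · exact key 1 (by simp) (by simp) h

lemma chainA_ncard {b : ℝ} (hb : b ∈ Set.Ioo (0 : ℝ) 1) :
    ({![1, 0, 1, 0, 1], ![1, 0, 1, b, 1], ![1, 0, 1, 1, 1]} : Set (Fin 5 → ℝ)).ncard = 3 := by
  rw [Set.ncard_insert_of_notMem, Set.ncard_pair]
  · intro h
    exact hb.2.ne (by simpa using congrFun h 3)
  · rintro (h | h)
    · exact hb.1.ne (by simpa using congrFun h 3)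
    · simpa using congrFun h 3

lemma chainA_waitValue_of_eq_zero (hη : IsStrategy η) (h₁ : η 1 = 0) (h₃ : η 3 = 0) :
    chainA.waitValue (2 / 5) η 1 =
      chainA.state 1 + 77 / 24 - 2 / 5 * √(197 / 8 - (77 / 24 : ℝ) ^ 2) ∧
    chainA.waitValue (2 / 5) η 3 =
      chainA.state 3 + 25 / 24 - 2 / 5 * √(61 / 8 - (25 / 24 : ℝ) ^ 2) := by
  obtain ⟨u, w, p, q, hA, hB, hA', hB', hu, hw, hp, hq⟩ := chainA_wait hη
  rw [h₁] at hp hq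
  rw [h₃] at hu hw
  obtain rfl : p = 25 / 24 := by linarith
  obtain rfl : u = 77 / 24 := by linarith
  obtain rfl : w = 197 / 8 := by linarith
  obtain rfl : q = 61 / 8 := by linarith
  exact ⟨waitValue_eq_of_centred hA hB, waitValue_eq_of_centred hA' hB'⟩

lemma chainA_waitValue_one_ge (hη : IsStrategy η) (h₁ : η 1 = 0) (h₃ : η 3 = 0) :
    chainA.state 1 + 169 / 100 ≤ chainA.waitValue (2 / 5) η 1 := by
  rw [(chainA_waitValue_of_eq_zero hη h₁ h₃).1]
  have : √(197 / 8 - (77 / 24 : ℝ) ^ 2) ≤ 379 / 100 := by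
    rw [Real.sqrt_le_left (by norm_num)]
    norm_num
  linarith

/-- The gain `169/100` separates never selling at 7 from both other equilibria, each of which sells
at least `17/20` there. -/
lemma chainA_waitValue_one_le (hη : IsStrategy η) (h₁ : η 1 = 0) (h₃ : 17 / 20 ≤ η 3) :
    chainA.waitValue (2 / 5) η 1 ≤ chainA.state 1 + 169 / 100 := by
  obtain ⟨u, w, p, q, hA, hB, hA', hB', hu, hw, hp, hq⟩ := chainA_wait hη
  have hs := one_sub_mem_Icc hη 3
  have hq₀ := (sq_nonneg p).trans (sq_le_of_centred hA' hB' chainA_converges hη)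
  obtain ⟨hp₀, hu₃, -⟩ := chainA_bound (one_sub_mem_Icc hη 1) hs hu hw hp hq
    ((sq_nonneg u).trans (sq_le_of_centred hA hB chainA_converges hη)) hq₀
  rw [h₁] at hp
  have hs' : 1 - η 3 ≤ 3 / 20 := by linarith
  generalize 1 - η 3 = s at hu hw hs hs'
  have hsp : s * p ≤ 3 / 20 * p := mul_le_mul_of_nonneg_right hs' hp₀
  have hsp₀ : 0 ≤ s * p := mul_nonneg hs.1 hp₀
  have hsq : 0 ≤ s ^ 2 * q := mul_nonneg (sq_nonneg s) hq₀
  have hu' : u ≤ 303 / 100 + 1 / 1000 := by linarith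
  have hw' : 103 / 5 ≤ w := by linarith
  have hu₂ : u ^ 2 ≤ (303 / 100 + 1 / 1000) ^ 2 := pow_le_pow_left₀ (by linarith) hu' 2
  have : 337 / 100 ≤ √(w - u ^ 2) := Real.le_sqrt_of_sq_le (by linarith)
  rw [waitValue_eq_of_centred hA hB]
  linarith

lemma chainA_isOptimal_iff {b : ℝ} (hb' : 17 / 20 < b)
    (H : ∀ {η : Fin 5 → ℝ}, chainA.IsEquilibrium (2 / 5) η ↔
      IsStrategy η ∧ η 1 = 0 ∧ (η 3 = 0 ∨ η 3 = b ∨ η 3 = 1))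
    (h : chainA.IsEquilibrium (2 / 5) η) : chainA.IsOptimal (2 / 5) η ↔ η 3 = 0 := by
  have hη := h.1
  have h₁ := (H.1 h).2.1
  constructor
  · intro hopt
    by_contra hne
    have hη₀ : IsStrategy ![1, 0, 1, 0, 1] := chainA_isStrategy (by simp)
    have heq : chainA.IsEquilibrium (2 / 5) ![1, 0, 1, 0, 1] := H.2 ⟨hη₀, rfl, Or.inl rfl⟩
    -- Never selling is worth strictly more than 7 at state 7, whereas an equilibrium selling there
    -- is worth at most 7.
    have hle := (hopt.2 _ heq 3).trans
      (objective_le_state chainA_converges h ((hη 3).1.lt_of_ne' hne))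
    rw [objective_of_eq_zero chainA_converges hη₀ rfl, (chainA_three_iff hη₀ rfl).1,
      show (![1, 0, 1, 0, 1] : Fin 5 → ℝ) 3 = 0 from rfl] at hle
    norm_num at hle
  · intro h₃
    refine ⟨h, fun η' h' x ↦ ?_⟩
    have hη' := h'.1
    obtain ⟨-, h₁', h₃'⟩ := H.1 h'
    fin_cases x
    · exact ((chainA_absorbing_zero.objective_eq chainA_converges hη' _).trans
        (chainA_absorbing_zero.objective_eq chainA_converges hη _).symm).le
    · change chainA.objective _ 1 _ ≤ chainA.objective _ 1 _
      rw [objective_of_eq_zero chainA_converges hη h₁, objective_of_eq_zero chainA_converges hη' h₁']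
      rcases h₃' with h₃' | h₃'
      · exact ((chainA_waitValue_of_eq_zero hη' h₁' h₃').1.trans
          (chainA_waitValue_of_eq_zero hη h₁ h₃).1.symm).le
      · refine (chainA_waitValue_one_le hη' h₁' ?_).trans (chainA_waitValue_one_ge hη h₁ h₃)
        rcases h₃' with h₃' | h₃' <;> rw [h₃']
        · exact hb'.le
        · norm_num
    · exact ((chainA_absorbing_two.objective_eq chainA_converges hη' _).trans
        (chainA_absorbing_two.objective_eq chainA_converges hη _).symm).le
    · change chainA.objective _ 3 _ ≤ chainA.objective _ 3 _
      rcases (hη' 3).1.eq_or_lt with h0 | h0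
      · rw [objective_of_eq_zero chainA_converges hη h₃,
          objective_of_eq_zero chainA_converges hη' h0.symm]
        exact ((chainA_waitValue_of_eq_zero hη' h₁' h0.symm).2.trans
          (chainA_waitValue_of_eq_zero hη h₁ h₃).2.symm).le
      · refine (objective_le_state chainA_converges h' h0).trans ?_
        rw [objective_of_eq_zero chainA_converges hη h₃, (chainA_three_iff hη h₁).2, h₃]
        norm_num
    · exact ((chainA_absorbing_four.objective_eq chainA_converges hη' _).trans
        (chainA_absorbing_four.objective_eq chainA_converges hη _).symm).le

end chainA

/-! ### The chain on {0, 11, 17, 18}. -/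

section chainB

open FiniteChain

variable {η : Fin 4 → ℝ}

lemma chainB_sum_one (f : Fin 4 → ℝ) :
    ∑ j, chainB.trans 1 j * f j = 1 / 10 * f 0 + 7 / 10 * f 1 + 1 / 5 * f 3 := by
  simp [Fin.sum_univ_four, chainB]

lemma chainB_sum_two (f : Fin 4 → ℝ) :
    ∑ j, chainB.trans 2 j * f j = 1 / 10 * f 1 + 1 / 10 * f 2 + 4 / 5 * f 3 := by
  simp [Fin.sum_univ_four, chainB]

lemma chainB_absorbing_zero : chainB.Absorbing 0 := by simp [Absorbing, chainB]

lemma chainB_absorbing_three : chainB.Absorbing 3 := by simp [Absorbing, chainB]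

lemma chainB_not_absorbing_one : ¬ chainB.Absorbing 1 := by norm_num [Absorbing, chainB]

lemma chainB_not_absorbing_two : ¬ chainB.Absorbing 2 := fun h ↦ by
  have h' : (1 / 10 : ℝ) = 1 := h
  norm_num at h'

lemma chainB_converges : chainB.Converges := by
  rw [converges_iff]
  have h := chainB.divergenceProb_eq_sum 1
  have h' := chainB.divergenceProb_eq_sum 2
  rw [chainB_sum_one, chainB_absorbing_zero.divergenceProb,
    chainB_absorbing_three.divergenceProb] at h
  rw [chainB_sum_two, chainB_absorbing_three.divergenceProb] at h'
  intro x
  fin_cases x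
  · exact chainB_absorbing_zero.divergenceProb
  · change chainB.divergenceProb 1 = 0
    linarith
  · change chainB.divergenceProb 2 = 0
    linarith
  · exact chainB_absorbing_three.divergenceProb

lemma chainB_wait (hη : IsStrategy η) : ∃ u w p q : ℝ,
    chainB.waitMean η 1 = chainB.state 1 + u ∧
    chainB.waitSecond η 1 = chainB.state 1 ^ 2 + 2 * chainB.state 1 * u + w ∧
    chainB.waitMean η 2 = chainB.state 2 + p ∧
    chainB.waitSecond η 2 = chainB.state 2 ^ 2 + 2 * chainB.state 2 * p + q ∧
    u * (1 - 7 / 10 * (1 - η 1)) = 3 / 10 ∧ w * (1 - 7 / 10 * (1 - η 1) ^ 2) = 219 / 10 ∧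
    p * (1 - 1 / 10 * (1 - η 2)) = 1 / 5 + 1 / 10 * (1 - η 1) * u ∧
    q * (1 - 1 / 10 * (1 - η 2) ^ 2) =
      22 / 5 - 6 / 5 * (1 - η 1) * u + 1 / 10 * (1 - η 1) ^ 2 * w := by
  have s₀ : chainB.state 0 = 0 := rfl
  have s₁ : chainB.state 1 = 11 := rfl
  have s₂ : chainB.state 2 = 17 := rfl
  have s₃ : chainB.state 3 = 18 := rfl
  have hA := chainB_sum_one (chainB.mean η)
  have hB := chainB_sum_one (chainB.secondMoment η)
  have hA' := chainB_sum_two (chainB.mean η)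
  have hB' := chainB_sum_two (chainB.secondMoment η)
  rw [chainB_absorbing_zero.mean_eq hη, chainB_absorbing_three.mean_eq hη,
    FiniteChain.mean_eq chainB_converges hη, ← waitMean, s₀, s₁, s₃] at hA
  rw [chainB_absorbing_zero.secondMoment_eq hη, chainB_absorbing_three.secondMoment_eq hη,
    FiniteChain.secondMoment_eq chainB_converges hη, ← waitSecond, s₀, s₁, s₃] at hB
  rw [chainB_absorbing_three.mean_eq hη, FiniteChain.mean_eq chainB_converges hη 1,
    FiniteChain.mean_eq chainB_converges hη 2, ← waitMean, s₁, s₂, s₃] at hA'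
  rw [chainB_absorbing_three.secondMoment_eq hη, FiniteChain.secondMoment_eq chainB_converges hη 1,
    FiniteChain.secondMoment_eq chainB_converges hη 2, ← waitSecond, s₁, s₂, s₃] at hB'
  refine ⟨chainB.waitMean η 1 - 11, chainB.waitSecond η 1 - 22 * chainB.waitMean η 1 + 121,
    chainB.waitMean η 2 - 17, chainB.waitSecond η 2 - 34 * chainB.waitMean η 2 + 289,
    ?_, ?_, ?_, ?_, ?_, ?_, ?_, ?_⟩
  · rw [s₁]; ring
  · rw [s₁]; ring
  · rw [s₂]; ring
  · rw [s₂]; ring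
  · linear_combination hA
  · linear_combination hB - 22 * hA
  · linear_combination hA'
  · linear_combination hB' - 34 * hA'

lemma nonneg_of_mul_one_sub {r k t c : ℝ} (hk : k ∈ Set.Ico (0 : ℝ) 1) (ht : t ∈ Set.Icc (0 : ℝ) 1)
    (h : r * (1 - k * t) = c) (hc : 0 ≤ c) : 0 ≤ r := by
  have : k * t ≤ k := mul_le_of_le_one_right hk.1 ht.2
  exact nonneg_of_mul_nonneg_left (hc.trans_eq h.symm) (by linarith [hk.2])

lemma mul_one_sub_sub {k t p q r y d : ℝ} (hp : p * (1 - k * t) = r) (hq : q * (1 - k * t ^ 2) = y) :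
    (d * p ^ 2 - q) * ((1 - k * t) ^ 2 * (1 - k * t ^ 2)) =
      d * r ^ 2 * (1 - k * t ^ 2) - y * (1 - k * t) ^ 2 := by
  subst hp hq
  ring

/-- The comparison of the first two moments `p` and `q` reduces to the sign of a quadratic
polynomial. -/
lemma moments_le_iff {k t p q r y d : ℝ} (hk : k ∈ Set.Ico (0 : ℝ) 1) (ht : t ∈ Set.Icc (0 : ℝ) 1)
    (hp : p * (1 - k * t) = r) (hq : q * (1 - k * t ^ 2) = y) :
    (d * p ^ 2 ≤ q ↔ d * r ^ 2 * (1 - k * t ^ 2) ≤ y * (1 - k * t) ^ 2) ∧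
    (q ≤ d * p ^ 2 ↔ y * (1 - k * t) ^ 2 ≤ d * r ^ 2 * (1 - k * t ^ 2)) := by
  have h₁ : k * t ≤ k := mul_le_of_le_one_right hk.1 ht.2
  have h₂ : k * t ^ 2 ≤ k := mul_le_of_le_one_right hk.1 (pow_le_one₀ ht.1 ht.2)
  have hpos : 0 < (1 - k * t) ^ 2 * (1 - k * t ^ 2) :=
    mul_pos (pow_pos (by linarith [hk.2]) 2) (by linarith [hk.2])
  have e := mul_one_sub_sub (d := d) hp hq
  constructor
  · rw [← sub_nonneg (b := d * p ^ 2), ← mul_nonneg_iff_of_pos_right hpos, ← neg_sub, neg_mul, e,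
      neg_sub, sub_nonneg]
  · rw [← sub_nonneg (b := q), ← mul_nonneg_iff_of_pos_right hpos, e, sub_nonneg]

lemma chainB_one_iff (hη : IsStrategy η) :
    (chainB.waitValue (1 / 10) η 1 ≤ chainB.state 1 ↔
      0 ≤ 17094 / 1000 * (1 - η 1) ^ 2 + -(3066 / 100) * (1 - η 1) + 1281 / 100) ∧
    (chainB.state 1 ≤ chainB.waitValue (1 / 10) η 1 ↔
      17094 / 1000 * (1 - η 1) ^ 2 + -(3066 / 100) * (1 - η 1) + 1281 / 100 ≤ 0) := by
  obtain ⟨u, w, p, q, hA, hB, -, -, hu, hw, -, -⟩ := chainB_wait hη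
  have ht := one_sub_mem_Icc hη 1
  have hu₀ := nonneg_of_mul_one_sub (by norm_num) ht hu (by norm_num)
  -- `101 = (1 + c²) / c²` for `c = 1/10`; the `k` of `moments_le_iff` is the holding probability
  -- `7/10`.
  have key := moments_le_iff (d := 101) (by norm_num) ht hu hw
  rw [waitValue_le_iff hA hB chainB_converges hη (by norm_num) hu₀,
    le_waitValue_iff hA hB (by norm_num) hu₀]
  constructor
  · rw [show (1 + (1 / 10 : ℝ) ^ 2) * u ^ 2 ≤ (1 / 10) ^ 2 * w ↔ 101 * u ^ 2 ≤ w by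
      constructor <;> intro h <;> linarith, key.1, ← sub_nonneg]
    ring_nf
  · rw [show (1 / 10) ^ 2 * w ≤ (1 + (1 / 10 : ℝ) ^ 2) * u ^ 2 ↔ w ≤ 101 * u ^ 2 by
      constructor <;> intro h <;> linarith, key.2, ← sub_nonpos]
    ring_nf

lemma chainB_two_iff (hη : IsStrategy η) : ∃ u w : ℝ, 0 ≤ u ∧
    u * (1 - 7 / 10 * (1 - η 1)) = 3 / 10 ∧ w * (1 - 7 / 10 * (1 - η 1) ^ 2) = 219 / 10 ∧
    (chainB.waitValue (1 / 10) η 2 ≤ chainB.state 2 ↔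
      101 * (1 / 5 + 1 / 10 * (1 - η 1) * u) ^ 2 * (1 - 1 / 10 * (1 - η 2) ^ 2) ≤
      (22 / 5 - 6 / 5 * (1 - η 1) * u + 1 / 10 * (1 - η 1) ^ 2 * w) *
        (1 - 1 / 10 * (1 - η 2)) ^ 2) ∧
    (chainB.state 2 ≤ chainB.waitValue (1 / 10) η 2 ↔
      (22 / 5 - 6 / 5 * (1 - η 1) * u + 1 / 10 * (1 - η 1) ^ 2 * w) *
        (1 - 1 / 10 * (1 - η 2)) ^ 2 ≤
      101 * (1 / 5 + 1 / 10 * (1 - η 1) * u) ^ 2 * (1 - 1 / 10 * (1 - η 2) ^ 2)) := by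
  obtain ⟨u, w, p, q, -, -, hA, hB, hu, hw, hp, hq⟩ := chainB_wait hη
  have ht := one_sub_mem_Icc hη 1
  have hs := one_sub_mem_Icc hη 2
  have hu₀ := nonneg_of_mul_one_sub (by norm_num) ht hu (by norm_num)
  have htu : 0 ≤ (1 - η 1) * u := mul_nonneg ht.1 hu₀
  have hp₀ := nonneg_of_mul_one_sub (by norm_num) hs hp (by linarith)
  have key := moments_le_iff (d := 101) (by norm_num) hs hp hq
  refine ⟨u, w, hu₀, hu, hw, ?_⟩
  rw [waitValue_le_iff hA hB chainB_converges hη (by norm_num) hp₀,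
    le_waitValue_iff hA hB (by norm_num) hp₀, ← key.1, ← key.2]
  constructor <;> constructor <;> intro h <;> linarith

lemma chainB_two_iff_of_eq_one (hη : IsStrategy η) (h₁ : η 1 = 1) :
    (chainB.waitValue (1 / 10) η 2 ≤ chainB.state 2 ↔
      0 ≤ 448 / 1000 * (1 - η 2) ^ 2 + -(88 / 100) * (1 - η 2) + 36 / 100) ∧
    (chainB.state 2 ≤ chainB.waitValue (1 / 10) η 2 ↔
      448 / 1000 * (1 - η 2) ^ 2 + -(88 / 100) * (1 - η 2) + 36 / 100 ≤ 0) := by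
  obtain ⟨u, w, -, -, -, h, h'⟩ := chainB_two_iff hη
  rw [h, h', h₁]
  constructor
  · rw [← sub_nonneg]
    ring_nf
  · rw [← sub_nonpos]
    ring_nf

lemma chainB_two_of_eq_zero (hη : IsStrategy η) (h₁ : η 1 = 0) :
    chainB.waitValue (1 / 10) η 2 < chainB.state 2 := by
  obtain ⟨u, w, -, hu, hw, -, h'⟩ := chainB_two_iff hη
  obtain ⟨hs₀, hs₁⟩ := one_sub_mem_Icc hη 2
  rw [h₁] at hu hw
  obtain rfl : u = 1 := by linarith
  obtain rfl : w = 73 := by linarith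
  rw [← not_le, h', h₁]
  nlinarith [sq_nonneg (1 - η 2 - 1)]

/-- Numerical: the interior root at 11 is located well enough to show that waiting at 17 is strictly
better whatever `η 2` is. -/
lemma chainB_two_of_root (hη : IsStrategy η) (h₁ : 1 - η 1 ∈ Set.Icc (66 / 100 : ℝ) (67 / 100))
    (hroot : 17094 / 1000 * (1 - η 1) ^ 2 + -(3066 / 100) * (1 - η 1) + 1281 / 100 = 0) :
    chainB.state 2 < chainB.waitValue (1 / 10) η 2 := by
  obtain ⟨u, w, hu₀, hu, hw, h, -⟩ := chainB_two_iff hη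
  have ht := one_sub_mem_Icc hη 1
  obtain ⟨hs₀, hs₁⟩ := one_sub_mem_Icc hη 2
  -- At the root, selling and waiting tie at 11; this eliminates `w` and leaves `x = t * u` as the
  -- only parameter inherited from 11.
  have hwu : w = 101 * u ^ 2 := by
    have key := moments_le_iff (d := 101) (by norm_num) ht hu hw
    refine le_antisymm (key.2.2 ?_) (key.1.2 ?_) <;> linarith
  rw [← not_le, h, hwu]
  generalize 1 - η 1 = t at *
  generalize 1 - η 2 = s at *
  have hu₁ : 557 / 1000 ≤ u := by
    by_contra! hlt
    nlinarith [h₁.1, h₁.2]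
  have hu₂ : u ≤ 566 / 1000 := by
    by_contra! hlt
    nlinarith [h₁.1, h₁.2]
  have hx₁ : 367 / 1000 ≤ t * u := by nlinarith [h₁.1]
  have hx₂ : t * u ≤ 380 / 1000 := by nlinarith [h₁.2]
  rw [mul_assoc (1 / 10) t u, mul_assoc (6 / 5) t u,
    show 1 / 10 * t ^ 2 * (101 * u ^ 2) = 101 / 10 * (t * u) ^ 2 by ring]
  generalize t * u = x at *
  have hr : 5655 / 1000 ≤ 101 * (1 / 5 + 1 / 10 * x) ^ 2 := by nlinarith
  have hy : 22 / 5 - 6 / 5 * x + 101 / 10 * x ^ 2 ≤ 542 / 100 := by nlinarith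
  have hs₂ : s ^ 2 ≤ s := by nlinarith
  have h₁ : 5655 / 1000 * (1 - 1 / 10 * s ^ 2) ≤
      101 * (1 / 5 + 1 / 10 * x) ^ 2 * (1 - 1 / 10 * s ^ 2) :=
    mul_le_mul_of_nonneg_right hr (by linarith)
  have h₂ : (22 / 5 - 6 / 5 * x + 101 / 10 * x ^ 2) * (1 - 1 / 10 * s) ^ 2 ≤
      542 / 100 * (1 - 1 / 10 * s) ^ 2 := mul_le_mul_of_nonneg_right hy (sq_nonneg _)
  have h₃ : 542 / 100 * (1 - 1 / 10 * s) ^ 2 < 5655 / 1000 * (1 - 1 / 10 * s ^ 2) := by nlinarith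
  linarith

lemma exists_chainB_isEquilibrium_iff : ∃ a ∈ Set.Ioo (0 : ℝ) 1, ∃ b ∈ Set.Ioo (0 : ℝ) 1,
    ∀ {η : Fin 4 → ℝ}, chainB.IsEquilibrium (1 / 10) η ↔ IsStrategy η ∧
      (η 1 = 1 ∧ (η 2 = 0 ∨ η 2 = b ∨ η 2 = 1) ∨ η 1 = 0 ∧ η 2 = 1 ∨ η 1 = a ∧ η 2 = 0) := by
  obtain ⟨a, ha, hroot, Ha⟩ := exists_best_response (α := 17094 / 1000) (β := -(3066 / 100))
    (γ := 1281 / 100) (by norm_num) (by norm_num) (by norm_num)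
  obtain ⟨b, hb, -, Hb⟩ := exists_best_response (α := 448 / 1000) (β := -(88 / 100))
    (γ := 36 / 100) (by norm_num) (by norm_num) (by norm_num)
  have hat : 1 - a ∈ Set.Icc (66 / 100 : ℝ) (67 / 100) := by
    constructor <;> nlinarith [ha.1, ha.2]
  refine ⟨a, ha, b, hb, fun {η} ↦ ?_⟩
  rw [isEquilibrium_iff_of_not_absorbing chainB_converges]
  refine and_congr_right fun hη ↦ ?_
  have h₁ := Ha _ (hη 1)
  rw [← (chainB_one_iff hη).1, ← (chainB_one_iff hη).2] at h₁
  have hall : (∀ x, ¬ chainB.Absorbing x →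
        (η x < 1 → chainB.state x ≤ chainB.waitValue (1 / 10) η x) ∧
          (0 < η x → chainB.waitValue (1 / 10) η x ≤ chainB.state x)) ↔
      (η 1 = 0 ∨ η 1 = a ∨ η 1 = 1) ∧ ((η 2 < 1 → chainB.state 2 ≤ chainB.waitValue (1 / 10) η 2) ∧
      (0 < η 2 → chainB.waitValue (1 / 10) η 2 ≤ chainB.state 2)) := by
    rw [← h₁]
    refine ⟨fun h ↦ ⟨h 1 chainB_not_absorbing_one, h 2 chainB_not_absorbing_two⟩, fun h x hx ↦ ?_⟩
    fin_cases x
    · exact (hx chainB_absorbing_zero).elim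
    · exact h.1
    · exact h.2
    · exact (hx chainB_absorbing_three).elim
  rw [hall]
  have hone (h : η 1 = 1) : ((η 2 < 1 → chainB.state 2 ≤ chainB.waitValue (1 / 10) η 2) ∧
      (0 < η 2 → chainB.waitValue (1 / 10) η 2 ≤ chainB.state 2)) ↔
      (η 2 = 0 ∨ η 2 = b ∨ η 2 = 1) := by
    rw [(chainB_two_iff_of_eq_one hη h).1, (chainB_two_iff_of_eq_one hη h).2, Hb _ (hη 2)]
  constructor
  · rintro ⟨h | h | h, h'⟩
    · refine Or.inr (Or.inl ⟨h, ?_⟩)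
      by_contra hne
      exact absurd (h'.1 ((hη 2).2.lt_of_ne hne)) (chainB_two_of_eq_zero hη h).not_ge
    · refine Or.inr (Or.inr ⟨h, ?_⟩)
      by_contra hne
      rw [← h] at hat hroot
      exact absurd (h'.2 ((hη 2).1.lt_of_ne' hne)) (chainB_two_of_root hη hat hroot).not_ge
    · exact Or.inl ⟨h, (hone h).1 h'⟩
  · rintro (⟨h, h'⟩ | ⟨h, h'⟩ | ⟨h, h'⟩)
    · exact ⟨Or.inr (Or.inr h), (hone h).2 h'⟩
    · exact ⟨Or.inl h, fun hlt ↦ (hlt.ne h').elim, fun _ ↦ (chainB_two_of_eq_zero hη h).le⟩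
    · rw [← h] at hat hroot
      exact ⟨Or.inr (Or.inl h), fun _ ↦ (chainB_two_of_root hη hat hroot).le,
        fun hlt ↦ (hlt.ne' h').elim⟩

lemma chainB_isStrategy {a b : ℝ} (ha : a ∈ Set.Icc (0 : ℝ) 1) (hb : b ∈ Set.Icc (0 : ℝ) 1) :
    IsStrategy ![1, a, b, 1] := by
  intro x
  fin_cases x
  · simp
  · exact ha
  · exact hb
  · simp

lemma chainB_equilibria {a b : ℝ} (ha : a ∈ Set.Ioo (0 : ℝ) 1) (hb : b ∈ Set.Ioo (0 : ℝ) 1)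
    (H : ∀ {η : Fin 4 → ℝ}, chainB.IsEquilibrium (1 / 10) η ↔ IsStrategy η ∧
      (η 1 = 1 ∧ (η 2 = 0 ∨ η 2 = b ∨ η 2 = 1) ∨ η 1 = 0 ∧ η 2 = 1 ∨ η 1 = a ∧ η 2 = 0)) :
    chainB.equilibria (1 / 10) =
      {![1, 1, 1, 1], ![1, 0, 1, 1], ![1, 1, 0, 1], ![1, a, 0, 1], ![1, 1, b, 1]} := by
  ext η
  simp only [equilibria, Set.mem_ofPred_eq, H, Set.mem_insert_iff, Set.mem_singleton_iff]
  constructor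
  · rintro ⟨⟨-, h⟩, hη⟩
    have key {x y : ℝ} (hx : η 1 = x) (hy : η 2 = y) : η = ![1, x, y, 1] := by
      have h₀ := hη 0 chainB_absorbing_zero
      have h₃ := hη 3 chainB_absorbing_three
      ext i
      fin_cases i <;> simp [h₀, h₃, hx, hy]
    rcases h with ⟨h, h' | h' | h'⟩ | ⟨h, h'⟩ | ⟨h, h'⟩ <;> simp [key h h']
  · have key (x y : ℝ) (hx : x ∈ Set.Icc (0 : ℝ) 1) (hy : y ∈ Set.Icc (0 : ℝ) 1)
        (h : x = 1 ∧ (y = 0 ∨ y = b ∨ y = 1) ∨ x = 0 ∧ y = 1 ∨ x = a ∧ y = 0)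
        (hη : η = ![1, x, y, 1]) : (IsStrategy η ∧
          (η 1 = 1 ∧ (η 2 = 0 ∨ η 2 = b ∨ η 2 = 1) ∨ η 1 = 0 ∧ η 2 = 1 ∨ η 1 = a ∧ η 2 = 0)) ∧
        ∀ x, chainB.Absorbing x → η x = 1 := by
      subst hη
      refine ⟨⟨chainB_isStrategy hx hy, h⟩, fun i hi ↦ ?_⟩
      fin_cases i
      · rfl
      · exact (chainB_not_absorbing_one hi).elim
      · exact (chainB_not_absorbing_two hi).elim
      · rfl
    rintro (h | h | h | h | h)
    · exact key 1 1 (by simp) (by simp) (by simp) h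
    · exact key 0 1 (by simp) (by simp) (by simp) h
    · exact key 1 0 (by simp) (by simp) (by simp) h
    · exact key a 0 ⟨ha.1.le, ha.2.le⟩ (by simp) (by simp) h
    · exact key 1 b (by simp) ⟨hb.1.le, hb.2.le⟩ (by simp) h

lemma chainB_ncard {a b : ℝ} (ha : a ∈ Set.Ioo (0 : ℝ) 1) (hb : b ∈ Set.Ioo (0 : ℝ) 1) :
    ({![1, 1, 1, 1], ![1, 0, 1, 1], ![1, 1, 0, 1], ![1, a, 0, 1], ![1, 1, b, 1]} :
      Set (Fin 4 → ℝ)).ncard = 5 := by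
  have ha₁ := ha.2.ne
  rw [Set.ncard_insert_of_notMem, Set.ncard_insert_of_notMem, Set.ncard_insert_of_notMem,
    Set.ncard_pair]
  all_goals simp [Matrix.vecCons_inj, ha₁, ha.1.ne, ha₁.symm, hb.1.ne, hb.2.ne']

/-- The equilibrium (0,1) is worth more than 11 at 11, and (1,0) more than 17 at 17, so an optimal
one would sell at neither state. But not selling at 11 makes waiting at 17 strictly worse than
selling. -/
lemma chainB_not_exists_isOptimal {a b : ℝ}
    (H : ∀ {η : Fin 4 → ℝ}, chainB.IsEquilibrium (1 / 10) η ↔ IsStrategy η ∧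
      (η 1 = 1 ∧ (η 2 = 0 ∨ η 2 = b ∨ η 2 = 1) ∨ η 1 = 0 ∧ η 2 = 1 ∨ η 1 = a ∧ η 2 = 0)) :
    ¬ ∃ η, chainB.IsOptimal (1 / 10) η := by
  rintro ⟨η, h, hopt⟩
  have hs₁ : IsStrategy ![1, 0, 1, 1] := chainB_isStrategy (by simp) (by simp)
  have hs₂ : IsStrategy ![1, 1, 0, 1] := chainB_isStrategy (by simp) (by simp)
  have h₁ := hopt _ (H.2 ⟨hs₁, Or.inr (Or.inl ⟨rfl, rfl⟩)⟩) 1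
  have h₂ := hopt _ (H.2 ⟨hs₂, Or.inl ⟨rfl, Or.inl rfl⟩⟩) 2
  rw [objective_of_eq_zero chainB_converges hs₁ rfl] at h₁
  rw [objective_of_eq_zero chainB_converges hs₂ rfl] at h₂
  have hη₁ : ¬ 0 < η 1 := fun hpos ↦ by
    have := h₁.trans (objective_le_state chainB_converges h hpos)
    rw [(chainB_one_iff hs₁).1, show (![1, 0, 1, 1] : Fin 4 → ℝ) 1 = 0 from rfl] at this
    norm_num at this
  have hη₂ : ¬ 0 < η 2 := fun hpos ↦ by
    have := h₂.trans (objective_le_state chainB_converges h hpos)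
    rw [(chainB_two_iff_of_eq_one hs₂ rfl).1,
      show (![1, 1, 0, 1] : Fin 4 → ℝ) 2 = 0 from rfl] at this
    norm_num at this
  have hlt := chainB_two_of_eq_zero h.1 (le_antisymm (not_lt.1 hη₁) (h.1 1).1)
  have hle := ((isEquilibrium_iff chainB_converges _).1 h).2 2 |>.1
    ((not_lt.1 hη₂).trans_lt one_pos)
  exact hle.not_gt hlt

end chainB

end Liquidation

end

theorem mainTheorem5 :
    -- `c = 0.4`, state space `{0, 1, 2, 7, 9}`: three equilibria, exactly one of them optimal
    (Liquidation.chainA.Converges ∧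
      (Liquidation.chainA.equilibria (2/5)).ncard = 3 ∧
      (∃ b₀ ∈ Set.Ioo (0 : ℝ) 1,
        Liquidation.chainA.equilibria (2/5) =
          {![1, 0, 1, 0, 1], ![1, 0, 1, b₀, 1], ![1, 0, 1, 1, 1]}) ∧
      (∀ η ∈ Liquidation.chainA.equilibria (2/5),
        Liquidation.chainA.IsOptimal (2/5) η ↔ η = ![1, 0, 1, 0, 1])) ∧
    -- `c = 0.1`, state space `{0, 11, 17, 18}`: five equilibria, none of them optimal
    (Liquidation.chainB.Converges ∧
      (Liquidation.chainB.equilibria (1/10)).ncard = 5 ∧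
      (∃ a₃ ∈ Set.Ioo (0 : ℝ) 1, ∃ b₀ ∈ Set.Ioo (0 : ℝ) 1,
        Liquidation.chainB.equilibria (1/10) =
          {![1, 1, 1, 1], ![1, 0, 1, 1], ![1, 1, 0, 1], ![1, a₃, 0, 1], ![1, 1, b₀, 1]}) ∧
      ¬ ∃ η, Liquidation.chainB.IsOptimal (1/10) η) ∧
    -- `c = 0.5`, state space `{0, 1, 4}`: two equilibria, both optimal
    (Liquidation.chainC.Converges ∧
      (Liquidation.chainC.equilibria (1/2)).ncard = 2 ∧
      Liquidation.chainC.equilibria (1/2) = {![1, 0, 1], ![1, 1, 1]} ∧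
      ∀ η ∈ Liquidation.chainC.equilibria (1/2), Liquidation.chainC.IsOptimal (1/2) η) := by
  refine ⟨?_, ?_, Liquidation.chainC_converges, Liquidation.chainC_ncard,
    Liquidation.chainC_equilibria, fun η hη ↦ Liquidation.chainC_isOptimal hη.1⟩
  · obtain ⟨b, hb, hb', H⟩ := Liquidation.exists_chainA_isEquilibrium_iff
    have heq := Liquidation.chainA_equilibria hb H
    refine ⟨Liquidation.chainA_converges, ?_, ⟨b, hb, heq⟩, fun η hη ↦ ?_⟩
    · rw [heq]
      exact Liquidation.chainA_ncard hb
    · rw [Liquidation.chainA_isOptimal_iff hb' H hη.1]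
      rw [heq] at hη
      rcases hη with rfl | rfl | rfl
      · simp
      · simp
      · simp
  · obtain ⟨a, ha, b, hb, H⟩ := Liquidation.exists_chainB_isEquilibrium_iff
    have heq := Liquidation.chainB_equilibria ha hb H
    refine ⟨Liquidation.chainB_converges, ?_, ⟨a, ha, b, hb, heq⟩,
      Liquidation.chainB_not_exists_isOptimal H⟩
    rw [heq]
    exact Liquidation.chainB_ncard ha hb
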